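/- Let $N$ be a non-negative integer, $K$ a field, $X=(x_1,\dots,x_{N-1})$ and $Y=(y_1,\dots,y_{N-2})$ sequences in $K$. The Okada algebra $O_N(X,Y)$ is the unital associative $K$-algebra generated by $E_1,\dots,E_{N-1}$ with relations $E_i^2=x_iE_i$, $E_iE_j=E_jE_i$ for $|i-j|\ge 2$, and $E_{i+1}E_iE_{i+1}=y_iE_{i+1}$ for $1\le i\le N-2$. For $\sigma\in\mathfrak S_N$ let $\ell(\sigma)$ be its number of inversions, let $c_i=\#\{j<i : \sigma^{-1}(j)>\sigma^{-1}(i)\}$, and put $E_\sigma=\prod_{i=1}^N E_{i-1}E_{i-2}\cdots E_{i-c_i}$ (factors written from left to right, $i$ increasing). A Fibonacci set of rank $N$ is a set $S=\{s_1<\dots<s_k\}\subseteq\{1,\dots,N\}$ with $k\equiv N$ and $s_l\equiv l \pmod 2$ for all $l$. Its free set is $\mathfrak F(S)=\{i\in\{1,\dots,N\}\setminus S : i-\max\{s\in S: s<i\}\text{ is odd}\}$ (with $\max\emptyset=0$), and its free element is $E_S=\prod_{i\in\mathfrak F(S)}E_i$ (the factors commute). For Fibonacci sets $S=\{s_1<\dots<s_k\}$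 and $T=\{t_1<\dots<t_m\}$ of rank $N$, write $S\preceq T$ if $k\le m$ and $s_{k-i}\le t_{m-i}$ for $0\le i<k$; this is a partial order, and $\inf$ denotes infima with respect to it. To each $E_\sigma$ belongs a height-labelled arc-diagram on the nodes $1,\dots,N$ (left) and $\overline1,\dots,\overline N$ (right), obtained by replacing each $E_i$ in the product by the elementary diagram $G_i$ with arcs $\{j,\overline j\}$ labelled $j$ ($j\ne i,i+1$), $\{i,i+1\}$ labelled $i$ and $\{\overline i,\overline{i+1}\}$ labelled $i$ (the empty product being the diagram with arcs $\{j,\overline j\}$ labelled $j$, $1\le j\le N$). Diagrams are composed by merging the right nodes of the first with the left nodes of the second, discarding loops, and giving each concatenated arc the minimum of the labels of its fragments. $\mathrm{PropLab}(E_\sigma)$ is the set of labels of the arcs of this diagram that join a left node to a right node. **Theorem (Triangular Factorization).** For every $\sigma\in\mathfrak S_N$ the set $S=\mathrm{PropLab}(E_\sigma)$ is a Fibonacci set of rank $N$, and there is a unique pair of permutations $\rho,\tau\in\mathfrak S_N$ such that $$E_\sigma=E_\rho\cdot E_S\cdot E_\tau\quad\text{in } O_N(X,Y)\qquad\text{and}\qquad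 \ell(\sigma)=\#\mathfrak F(S)+\ell(\rho)+\ell(\tau).$$ Moreover, for this pair, $\mathrm{PropLab}(E_\rho)$ and $\mathrm{PropLab}(E_\tau)$ are Fibonacci sets of rank $N$, their infimum exists, and $S\preceq\inf(\mathrm{PropLab}(E_\rho),\mathrm{PropLab}(E_\tau))$. -/

import Mathlib

/-! ## Fibonacci sets and the dominance order -/

/-- A Fibonacci set of rank `N`: a subset `{s₁ < ⋯ < s_k}` of `{1, …, N}` with `k ≡ N (mod 2)`
and `s_l ≡ l (mod 2)` for all `l`. The position of `s` in the set is `#{t ∈ S | t ≤ s}`. -/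
@[ext]
structure FibonacciSet (N : ℕ) where
  carrier : Finset ℕ
  subset_Icc : carrier ⊆ Finset.Icc 1 N
  card_parity : carrier.card ≡ N [MOD 2]
  elem_parity : ∀ s ∈ carrier, s ≡ (carrier.filter (fun t => t ≤ s)).card [MOD 2]

namespace FibonacciSet

/-- The elements in decreasing order: entry number `i` (counted from `0`) is `s_{k-i}`. -/
def desc {N : ℕ} (S : FibonacciSet N) : List ℕ := S.carrier.sort (fun a b => a ≥ b)

theorem length_desc {N : ℕ} (S : FibonacciSet N) : S.desc.length = S.carrier.card :=
  Finset.length_sort _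

/-- `S` is dominated by `T`: `k ≤ l` and `s_{k-i} ≤ t_{l-i}` for `0 ≤ i < k`,
where `k = #S` and `l = #T`. -/
def Dominated {N : ℕ} (S T : FibonacciSet N) : Prop :=
  S.carrier.card ≤ T.carrier.card ∧
    ∀ i < S.carrier.card, S.desc.getD i 0 ≤ T.desc.getD i 0

instance instPartialOrder (N : ℕ) : PartialOrder (FibonacciSet N) where
  le S T := Dominated S T
  le_refl _ := ⟨le_rfl, fun _ _ => le_rfl⟩
  le_trans _ _ _ h₁ h₂ :=
    ⟨h₁.1.trans h₂.1, fun i hi => (h₁.2 i hi).trans (h₂.2 i (hi.trans_le h₁.1))⟩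
  le_antisymm S T h₁ h₂ := by
    have hc : S.carrier.card = T.carrier.card := le_antisymm h₁.1 h₂.1
    have hd : S.desc = T.desc := by
      refine List.ext_getElem (by rw [length_desc, length_desc, hc]) ?_
      intro i hi hi'
      have a := h₁.2 i (by rwa [← length_desc])
      have b := h₂.2 i (by rwa [← length_desc])
      rw [List.getD_eq_getElem _ _ hi, List.getD_eq_getElem _ _ hi'] at a b
      exact le_antisymm a b
    ext x
    have hS : x ∈ S.desc ↔ x ∈ S.carrier := Finset.mem_sort _
    have hT : x ∈ T.desc ↔ x ∈ T.carrier := Finset.mem_sort _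
    rw [← hS, ← hT, hd]

/-- The free set `𝔉(S)`: those `i ∈ {1, …, N} \ S` for which `i - max {s ∈ S | s < i}` is odd,
with the convention `max ∅ = 0`. -/
def freeSet {N : ℕ} (S : FibonacciSet N) : Finset ℕ :=
  (Finset.Icc 1 N).filter
    (fun i => i ∉ S.carrier ∧ Odd (i - (S.carrier.filter (fun s => s < i)).sup id))

end FibonacciSet

/-! ## Permutations

A permutation of `{1, …, N}` is an element of `Equiv.Perm (Fin N)`, where `k : Fin N` stands for
the number `k + 1`. -/

/-- The number of inversions of `σ`, that is, its Coxeter length. -/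
def permLength {N : ℕ} (σ : Equiv.Perm (Fin N)) : ℕ :=
  (Finset.univ.filter (fun p : Fin N × Fin N => p.1 < p.2 ∧ σ p.2 < σ p.1)).card

/-- The code of `σ`: `c_i = #{j < i | σ⁻¹ j > σ⁻¹ i}`. -/
def permCode {N : ℕ} (σ : Equiv.Perm (Fin N)) (i : Fin N) : ℕ :=
  (Finset.univ.filter (fun j : Fin N => j < i ∧ σ.symm i < σ.symm j)).card

/-- The word of indices `∏_{i = 1}^{N} (i-1) (i-2) ⋯ (i-c_i)`, read from left to right.
All its letters lie in `{1, …, N - 1}`. -/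
def permWord {N : ℕ} (σ : Equiv.Perm (Fin N)) : List ℕ :=
  (List.finRange N).flatMap (fun i => (List.range (permCode σ i)).map (fun k => (i : ℕ) - k))

theorem permCode_le {N : ℕ} (σ : Equiv.Perm (Fin N)) (i : Fin N) : permCode σ i ≤ i := by
  calc permCode σ i ≤ (Finset.Iio i).card :=
        Finset.card_le_card (fun j hj => by
          rw [Finset.mem_filter] at hj
          exact Finset.mem_Iio.2 hj.2.1)
    _ = i := Fin.card_Iio i

theorem permWord_range {N : ℕ} (σ : Equiv.Perm (Fin N)) :
    ∀ m ∈ permWord σ, 1 ≤ m ∧ m < N := by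
  intro m hm
  obtain ⟨i, -, hi⟩ := List.mem_flatMap.1 hm
  obtain ⟨k, hk, rfl⟩ := List.mem_map.1 hi
  have h₁ := List.mem_range.1 hk
  have h₂ := permCode_le σ i
  have h₃ := i.isLt
  omega

/-! ## The Okada algebra

Generators are indexed by `Fin (N - 1)`, where `k` stands for the generator `E_{k+1}`; likewise
`X k` is the parameter `x_{k+1}` and `Y k` is the parameter `y_{k+1}`. -/

/-- The defining relations of the Okada algebra. -/
inductive OkadaRel {K : Type*} [Field K] (N : ℕ) (X : Fin (N - 1) → K) (Y : Fin (N - 2) → K) :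
    FreeAlgebra K (Fin (N - 1)) → FreeAlgebra K (Fin (N - 1)) → Prop
  | idem (i : Fin (N - 1)) :
      OkadaRel N X Y (FreeAlgebra.ι K i * FreeAlgebra.ι K i) (X i • FreeAlgebra.ι K i)
  | comm (i j : Fin (N - 1)) (h : (i : ℕ) + 2 ≤ j) :
      OkadaRel N X Y (FreeAlgebra.ι K i * FreeAlgebra.ι K j)
        (FreeAlgebra.ι K j * FreeAlgebra.ι K i)
  | shift (i j : Fin (N - 1)) (k : Fin (N - 2)) (hi : (i : ℕ) = k) (hj : (j : ℕ) = k + 1) :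
      OkadaRel N X Y (FreeAlgebra.ι K j * FreeAlgebra.ι K i * FreeAlgebra.ι K j)
        (Y k • FreeAlgebra.ι K j)

/-- The Okada algebra of rank `N` with parameters `X`, `Y`. -/
abbrev OkadaAlgebra {K : Type*} [Field K] (N : ℕ) (X : Fin (N - 1) → K) (Y : Fin (N - 2) → K) :=
  RingQuot (OkadaRel N X Y)

/-- The generator `E_i` for `1 ≤ i ≤ N - 1` (and, as a dummy value, `1` for other `i`). -/
noncomputable def okadaGen {K : Type*} [Field K] (N : ℕ) (X : Fin (N - 1) → K)
    (Y : Fin (N - 2) → K) (i : ℕ) : OkadaAlgebra N X Y :=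
  if h : 1 ≤ i ∧ i < N then
    RingQuot.mkAlgHom K (OkadaRel N X Y) (FreeAlgebra.ι K (⟨i - 1, by omega⟩ : Fin (N - 1)))
  else 1

/-- The basis element `E_σ = ∏_{i = 1}^{N} E_{i-1} E_{i-2} ⋯ E_{i-c_i}`. -/
noncomputable def okadaPerm {K : Type*} [Field K] (N : ℕ) (X : Fin (N - 1) → K)
    (Y : Fin (N - 2) → K) (σ : Equiv.Perm (Fin N)) : OkadaAlgebra N X Y :=
  ((permWord σ).map (okadaGen N X Y)).prod

/-- The free element `E_S`, the product of the (pairwise commuting) `E_i` with `i ∈ 𝔉(S)`. -/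
noncomputable def okadaFree {K : Type*} [Field K] (N : ℕ) (X : Fin (N - 1) → K)
    (Y : Fin (N - 2) → K) (S : FibonacciSet N) : OkadaAlgebra N X Y :=
  ((S.freeSet.sort (fun a b => a ≤ b)).map (okadaGen N X Y)).prod

/-! ## Height-labelled arc-diagrams

A height-labelled arc-diagram of rank `N` is recorded by its set of arcs `(s(a, b), h)`, where `h`
is the height label and `a`, `b` are boundary nodes: `Sum.inl k` is the left node `k + 1` and
`Sum.inr k` is the right node `k + 1` (with a bar). -/

/-- A set of height-labelled arcs on the `2N` boundary nodes. -/
abbrev LabelledArcs (N : ℕ) := Set (Sym2 (Fin N ⊕ Fin N) × ℕ)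

namespace LabelledArcs

/-- The nodes of a concatenation: left, middle (where the two diagrams are merged) and right. -/
inductive GluedNode (N : ℕ) : Type
  | left (k : Fin N)
  | mid (k : Fin N)
  | right (k : Fin N)

/-- The nodes of the first diagram, placed in the concatenation. -/
def fstNode {N : ℕ} : Fin N ⊕ Fin N → GluedNode N
  | Sum.inl k => GluedNode.left k
  | Sum.inr k => GluedNode.mid k

/-- The nodes of the second diagram, placed in the concatenation. -/
def sndNode {N : ℕ} : Fin N ⊕ Fin N → GluedNode N
  | Sum.inl k => GluedNode.mid k
  | Sum.inr k => GluedNode.right k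

/-- The boundary nodes of the concatenation. -/
def outerNode {N : ℕ} : Fin N ⊕ Fin N → GluedNode N
  | Sum.inl k => GluedNode.left k
  | Sum.inr k => GluedNode.right k

/-- `C` or `D` has an arc fragment with label `h` that joins the nodes `u` and `v`. -/
def Fragment {N : ℕ} (C D : LabelledArcs N) (u v : GluedNode N) (h : ℕ) : Prop :=
  (∃ a b, (s(a, b), h) ∈ C ∧ u = fstNode a ∧ v = fstNode b) ∨
    (∃ a b, (s(a, b), h) ∈ D ∧ u = sndNode a ∧ v = sndNode b)

/-- `u` and `v` lie on the same concatenated arc (or loop). -/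
def Linked {N : ℕ} (C D : LabelledArcs N) : GluedNode N → GluedNode N → Prop :=
  Relation.ReflTransGen (fun u v => ∃ h, Fragment C D u v h)

/-- The composition: two distinct boundary nodes form an arc if they are linked, and its label is
the minimum of the labels of the fragments that make it up. Loops are discarded. -/
def comp {N : ℕ} (C D : LabelledArcs N) : LabelledArcs N :=
  {p | ∃ a b, a ≠ b ∧ p.1 = s(a, b) ∧ Linked C D (outerNode a) (outerNode b) ∧
    IsLeast {h | ∃ u v, Linked C D (outerNode a) u ∧ Fragment C D u v h} p.2}

/-- The identity diagram: propagating arcs from `a` to `a` (with a bar), with label `a`. -/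
def identity (N : ℕ) : LabelledArcs N :=
  {p | ∃ j : Fin N, p = (s(Sum.inl j, Sum.inr j), (j : ℕ) + 1)}

/-- The elementary diagram `G_i`, for `1 ≤ i < N`: arcs from `j` to `j` (with a bar) with label `j`
for `j ≠ i, i + 1`, and on either side an arc from `i` to `i + 1` with label `i`. -/
def elementary (N i : ℕ) : LabelledArcs N :=
  {p | (∃ j : Fin N, (j : ℕ) + 1 ≠ i ∧ (j : ℕ) + 1 ≠ i + 1 ∧
          p = (s(Sum.inl j, Sum.inr j), (j : ℕ) + 1)) ∨
       (∃ a b : Fin N, (a : ℕ) + 1 = i ∧ (b : ℕ) + 1 = i + 1 ∧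
          (p = (s(Sum.inl a, Sum.inl b), i) ∨ p = (s(Sum.inr a, Sum.inr b), i)))}

/-- The Okada arc-diagram of `E_σ`, i.e. its image under the identification `E_i ↦ G_i` of the
Okada algebra with the diagram algebra: the product `∏_{i = 1}^{N} G_{i-1} G_{i-2} ⋯ G_{i-c_i}`.
This product of diagrams is free of loops and it does not depend on the parameters. -/
def ofPerm {N : ℕ} (σ : Equiv.Perm (Fin N)) : LabelledArcs N :=
  ((permWord σ).map (elementary N)).foldr comp (identity N)

/-- The set of height labels of the propagating arcs, those joining a left and a right node. -/
def propLab {N : ℕ} (D : LabelledArcs N) : Set ℕ :=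
  {h | ∃ a b : Fin N, (s(Sum.inl a, Sum.inr b), h) ∈ D}

end LabelledArcs

/-! ## Words up to commutation -/

/-! The algebra and the diagrams are both controlled by words up to commutation of distant letters.
Such classes are encoded by the projections of a word to each pair `c`, `c + 1` (`TraceEq`). A word
is reduced when no letter `c` recurs without a `c + 1` in between, and the words of permutations are
normal forms of the reduced words.

To pass from the algebra to words, multiplication by a generator is modelled as an action on codes
(`codeAct`), which satisfies the defining relations (`codeAct_relations`). Acting with a word yields
a code whose word is strictly shorter, unless it is equivalent to the concatenation
(`codeStep_foldl`); for reduced words nothing is lost. Hence reduced words have normal forms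
(`ReducedWord.exists_perm`), and an equality between `E_σ` and a product of `ℓ(σ)` generators forces
equivalence of words (`traceEq_of_okadaPerm_eq`). The theorem becomes a statement on reduced words.

Existence: the largest possible letter occurs at most once in a reduced word. If it occurs, a
descending block splits off on the right and an ascending block on the left, and what remains lives
in rank lower by two (`ReducedWord.exists_triangularWord`). The construction also controls the
letters at the cut. Uniqueness: with this control, the projections of the left factor are determined
one after another, from the largest `c` downwards (`TriangularWord.unique`).

Labels: multiplying a diagram by a generator reconnects one side of a labelled matching. The number
of propagating labels `≥ x` never grows, and domination of Fibonacci sets is exactly the comparison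
of these numbers (`le_iff_countGe`), whence the inequality. For the factors of a triangular
factorization, each letter `i` meets an arc of label `i + 1` on its own side, so no propagating
label changes at all (`SideInvariant.foldr`), and the labels of `E_σ` are those of the free element,
namely `S`. -/

/-- The subword of `w` formed by the letters `c` and `c + 1`. -/
def adjFilter (c : ℕ) (w : List ℕ) : List ℕ := w.filter (fun x => x = c ∨ x = c + 1)

/-- Equality of words up to commutation of letters that differ by at least `2`. -/
def TraceEq (u v : List ℕ) : Prop := ∀ c, adjFilter c u = adjFilter c v

/-- Between any two occurrences of a letter `c` there is a letter `c + 1`. -/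
def ReducedWord (w : List ℕ) : Prop := ∀ c, ¬ [c, c] <:+: adjFilter c w

@[simp] theorem adjFilter_nil (c : ℕ) : adjFilter c [] = [] := rfl

@[simp] theorem adjFilter_append (c : ℕ) (u v : List ℕ) :
    adjFilter c (u ++ v) = adjFilter c u ++ adjFilter c v := by simp [adjFilter]

theorem adjFilter_cons (c a : ℕ) (u : List ℕ) :
    adjFilter c (a :: u) = if a = c ∨ a = c + 1 then a :: adjFilter c u else adjFilter c u := by
  simp [adjFilter, List.filter_cons]

theorem adjFilter_singleton (c a : ℕ) :
    adjFilter c [a] = if a = c ∨ a = c + 1 then [a] else [] := by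
  simp [adjFilter_cons]

theorem adjFilter_reverse (c : ℕ) (u : List ℕ) :
    adjFilter c u.reverse = (adjFilter c u).reverse := by simp [adjFilter]

theorem mem_adjFilter {c a : ℕ} {u : List ℕ} :
    a ∈ adjFilter c u ↔ a ∈ u ∧ (a = c ∨ a = c + 1) := by simp [adjFilter]

theorem adjFilter_eq_nil {c : ℕ} {u : List ℕ} (h : ∀ a ∈ u, a ≠ c ∧ a ≠ c + 1) :
    adjFilter c u = [] := by
  rw [List.eq_nil_iff_forall_not_mem]
  intro a ha
  rw [mem_adjFilter] at ha
  have := h a ha.1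
  omega

theorem count_adjFilter {c a : ℕ} (u : List ℕ) (h : a = c ∨ a = c + 1) :
    (adjFilter c u).count a = u.count a := by
  rw [adjFilter, List.count_filter]; simpa using h

namespace TraceEq

theorem refl (u : List ℕ) : TraceEq u u := fun _ => rfl

theorem symm {u v : List ℕ} (h : TraceEq u v) : TraceEq v u := fun c => (h c).symm

theorem trans {u v w : List ℕ} (h : TraceEq u v) (h' : TraceEq v w) : TraceEq u w :=
  fun c => (h c).trans (h' c)

theorem append {u v u' v' : List ℕ} (h : TraceEq u u') (h' : TraceEq v v') :
    TraceEq (u ++ v) (u' ++ v') := fun c => by simp [h c, h' c]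

theorem append_left {v v' : List ℕ} (u : List ℕ) (h' : TraceEq v v') :
    TraceEq (u ++ v) (u ++ v') := (refl u).append h'

theorem append_right {u u' : List ℕ} (h : TraceEq u u') (v : List ℕ) :
    TraceEq (u ++ v) (u' ++ v) := h.append (refl v)

theorem reverse {u v : List ℕ} (h : TraceEq u v) : TraceEq u.reverse v.reverse := fun c => by
  rw [adjFilter_reverse, adjFilter_reverse, h c]

theorem perm {u v : List ℕ} (h : TraceEq u v) : u.Perm v := by
  rw [List.perm_iff_count]
  intro a
  rw [← count_adjFilter u (Or.inl rfl), h a, count_adjFilter v (Or.inl rfl)]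

theorem mem_iff {u v : List ℕ} (h : TraceEq u v) (a : ℕ) : a ∈ u ↔ a ∈ v := h.perm.mem_iff

/-- For each `c`, at most one of the two words meets `{c, c + 1}`, so one of the two projections is
empty. -/
theorem append_comm {u v : List ℕ} (h : ∀ a ∈ u, ∀ b ∈ v, a + 2 ≤ b ∨ b + 2 ≤ a) :
    TraceEq (u ++ v) (v ++ u) := by
  intro c
  rw [adjFilter_append, adjFilter_append]
  by_cases hu : adjFilter c u = []
  · simp [hu]
  · obtain ⟨a, ha⟩ := List.exists_mem_of_ne_nil _ hu
    rw [mem_adjFilter] at ha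
    have : adjFilter c v = [] := adjFilter_eq_nil fun b hb => by
      have := h a ha.1 b hb
      omega
    simp [this]

theorem reducedWord {u v : List ℕ} (h : TraceEq u v) (hu : ReducedWord u) : ReducedWord v :=
  fun c => by rw [← h c]; exact hu c

/-- The first letter `a` of a word can be found in an equivalent word, preceded only by letters
that commute with it. -/
theorem exists_split {a : ℕ} {u v : List ℕ} (h : TraceEq (a :: u) v) :
    ∃ v₁ v₂, v = v₁ ++ a :: v₂ ∧ (∀ b ∈ v₁, a + 2 ≤ b ∨ b + 2 ≤ a) ∧ TraceEq u (v₁ ++ v₂) := by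
  have hmem : a ∈ v := (h.mem_iff a).1 (by simp)
  obtain ⟨v₁, v₂, rfl, hv⟩ := List.eq_append_cons_of_mem hmem
  have hfar : ∀ b ∈ v₁, a + 2 ≤ b ∨ b + 2 ≤ a := by
    intro b hb
    by_contra hcon
    have hne : b ≠ a := fun e => hv (e ▸ hb)
    -- A projection that sees both `a` and `b` starts with `a` for the first word, but with a letter
    -- of `v₁` for the second, and `a` is not in `v₁`.
    have key : ∀ c, (a = c ∨ a = c + 1) → (b = c ∨ b = c + 1) → False := by
      intro c hac hbc
      have e := h c
      rw [adjFilter_cons, if_pos hac, adjFilter_append] at e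
      have hb' : b ∈ adjFilter c v₁ := mem_adjFilter.2 ⟨hb, hbc⟩
      cases hl : adjFilter c v₁ with
      | nil => simp [hl] at hb'
      | cons d l =>
        rw [hl, List.cons_append, List.cons.injEq] at e
        have hd : d ∈ adjFilter c v₁ := by simp [hl]
        rw [← e.1, mem_adjFilter] at hd
        exact hv hd.1
    rcases Nat.lt_or_gt_of_ne hne with hlt | hlt
    · exact key b (by omega) (by omega)
    · exact key a (by omega) (by omega)
  refine ⟨v₁, v₂, rfl, hfar, fun c => ?_⟩
  have e := h c
  rw [adjFilter_cons, adjFilter_append, adjFilter_cons] at e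
  rw [adjFilter_append]
  split_ifs at e with hac
  · have : adjFilter c v₁ = [] := adjFilter_eq_nil fun b hb => by
      have := hfar b hb
      omega
    simpa [this] using e
  · exact e

/-- Equal projections do imply equality up to commutations: the first letter of one word can be
pulled to the front of the other. Stated for any monoid, since it serves both for the algebra and
for operators on matchings. -/
theorem prod_map_eq {M : Type*} [Monoid M] (f : ℕ → M) {u v : List ℕ}
    (hf : ∀ a ∈ u, ∀ b ∈ u, a + 2 ≤ b → Commute (f a) (f b)) (h : TraceEq u v) :
    (u.map f).prod = (v.map f).prod := by
  induction u generalizing v with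
  | nil =>
    have := h.perm.symm.eq_nil
    simp [this]
  | cons a u ih =>
    obtain ⟨v₁, v₂, rfl, hfar, h'⟩ := h.exists_split
    have hc : Commute (f a) ((v₁.map f).prod) := by
      refine Commute.list_prod_right _ _ fun y hy => ?_
      obtain ⟨b, hb, rfl⟩ := List.mem_map.1 hy
      have hb' : b ∈ a :: u := (h.mem_iff b).2 (by simp [hb])
      rcases hfar b hb with hab | hab
      · exact hf a (by simp) b hb' hab
      · exact (hf b hb' a (by simp) hab).symm
    rw [List.map_cons, List.prod_cons, ih (fun a ha b hb => hf a (by simp [ha]) b (by simp [hb])) h']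
    simp only [List.map_append, List.prod_append, List.map_cons, List.prod_cons]
    rw [← mul_assoc, hc.eq, mul_assoc]

end TraceEq

namespace ReducedWord

theorem of_infix {u w : List ℕ} (hw : ReducedWord w) (h : u <:+: w) : ReducedWord u :=
  fun c hc => hw c (hc.trans (h.filter _))

theorem of_append_left {u v : List ℕ} (h : ReducedWord (u ++ v)) : ReducedWord u :=
  h.of_infix (List.prefix_append u v).isInfix

theorem of_append_right {u v : List ℕ} (h : ReducedWord (u ++ v)) : ReducedWord v :=
  h.of_infix (List.suffix_append u v).isInfix

/-- This symmetry allows normal forms to be taken from the left end of a word as well. -/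
theorem reverse {w : List ℕ} (h : ReducedWord w) : ReducedWord w.reverse := by
  intro c hc
  rw [adjFilter_reverse, ← List.reverse_infix, List.reverse_reverse] at hc
  exact h c (by simpa using hc)

theorem nil : ReducedWord [] := fun c => by simp

end ReducedWord

/-- The word `(b - 1) (b - 2) ⋯ a`. -/
def descWord (a b : ℕ) : List ℕ := (List.range' a (b - a)).reverse

theorem mem_descWord {a b i : ℕ} : i ∈ descWord a b ↔ a ≤ i ∧ i < b := by
  simp [descWord, List.mem_range'_1]; omega

theorem length_descWord (a b : ℕ) : (descWord a b).length = b - a := by simp [descWord]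

theorem descWord_of_le {a b : ℕ} (h : b ≤ a) : descWord a b = [] := by
  simp [descWord, Nat.sub_eq_zero_of_le h]

theorem descWord_append {a b c : ℕ} (h : a ≤ b) (h' : b ≤ c) :
    descWord b c ++ descWord a b = descWord a c := by
  rw [descWord, descWord, descWord, ← List.reverse_append]
  congr 1
  have := @List.range'_append_1 a (b - a) (c - b)
  rw [show a + (b - a) = b by omega, show b - a + (c - b) = c - a by omega] at this
  exact this

theorem descWord_self_succ (a : ℕ) : descWord a (a + 1) = [a] := by
  simp [descWord]

theorem descWord_succ {a b : ℕ} (h : a < b) : descWord a b = descWord (a + 1) b ++ [a] := by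
  rw [← descWord_self_succ, descWord_append (by omega) (by omega)]

theorem descWord_succ' {a b : ℕ} (h : a ≤ b) : descWord a (b + 1) = b :: descWord a b := by
  rw [← descWord_append h (Nat.le_succ b), descWord_self_succ]; rfl

/-! ## Codes and the regular representation -/

/-- Codes of rank `n`: the code `u.snoc m` of rank `n + 1` stands for the word of `u`, followed by
`n (n - 1) ⋯ m`. -/
inductive OkadaCode : ℕ → Type
  | nil : OkadaCode 0
  | snoc {n : ℕ} (u : OkadaCode n) (m : ℕ) : OkadaCode (n + 1)

/-- Appends the same entry to the code of a multiple of a code. -/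
def snocScaled {K : Type*} {n : ℕ} (s : K × OkadaCode n) (m : ℕ) : K × OkadaCode (n + 1) :=
  (s.1, s.2.snoc m)

/-- The right action of the generators on multiples of codes. -/
def codeAct {K : Type*} [CommRing K] (x y : ℕ → K) :
    (n : ℕ) → K × OkadaCode n → ℕ → K × OkadaCode n
  -- The coefficient `0` makes all relations trivial in rank `0`; valid codes and letters in range
  -- never lead here.
  | 0, s, _ => (0, s.2)
  | n + 1, (k, .snoc u m), i =>
    if i + 1 < m then snocScaled (codeAct x y n (k, u) i) m
    else if i + 1 = m then (k, u.snoc i)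
    else if i = m then (x i * k, u.snoc m)
    -- Here `i` lies inside the block `n ⋯ m`. It moves left past `(i-2) ⋯ m` and meets `i (i-1)`,
    -- which gives `i (i-1) i = y_{i-1} i`. The detached letters `(i-2) ⋯ m` commute with `n ⋯ i`
    -- and act on `u`.
    else snocScaled ((descWord m (i - 1)).foldl (codeAct x y n) (y (i - 1) * k, u)) i

section

variable {K : Type*} [CommRing K] (x y : ℕ → K)

theorem codeAct_of_lt {n : ℕ} (s : K × OkadaCode n) {m i : ℕ} (h : i + 1 < m) :
    codeAct x y (n + 1) (snocScaled s m) i = snocScaled (codeAct x y n s i) m := by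
  rw [snocScaled, codeAct, if_pos h]

theorem codeAct_of_succ_eq {n : ℕ} (s : K × OkadaCode n) (i : ℕ) :
    codeAct x y (n + 1) (snocScaled s (i + 1)) i = snocScaled s i := by
  rw [snocScaled, codeAct, if_neg (by omega), if_pos rfl]; rfl

theorem codeAct_of_eq {n : ℕ} (s : K × OkadaCode n) (i : ℕ) :
    codeAct x y (n + 1) (snocScaled s i) i = snocScaled (x i * s.1, s.2) i := by
  rw [snocScaled, codeAct, if_neg (by omega), if_neg (by omega), if_pos rfl]; rfl

theorem codeAct_of_gt {n : ℕ} (s : K × OkadaCode n) {m i : ℕ} (h : m < i) :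
    codeAct x y (n + 1) (snocScaled s m) i =
      snocScaled ((descWord m (i - 1)).foldl (codeAct x y n) (y (i - 1) * s.1, s.2)) i := by
  rw [snocScaled, codeAct, if_neg (by omega), if_neg (by omega), if_neg (by omega)]

theorem exists_eq_snocScaled {K : Type*} {n : ℕ} (s : K × OkadaCode (n + 1)) :
    ∃ (t : K × OkadaCode n) (m : ℕ), s = snocScaled t m := by
  obtain ⟨k, ⟨⟩ | ⟨u, m⟩⟩ := s
  exact ⟨(k, u), m, rfl⟩

theorem foldl_scale_of {S : Type*} {f : K × S → ℕ → K × S}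
    (h : ∀ (a : K) (s : K × S) (i : ℕ), f (a * s.1, s.2) i = (a * (f s i).1, (f s i).2))
    (w : List ℕ) (a : K) (s : K × S) :
    w.foldl f (a * s.1, s.2) = (a * (w.foldl f s).1, (w.foldl f s).2) := by
  induction w generalizing s with
  | nil => rfl
  | cons i w ih => rw [List.foldl_cons, h, ih]; rfl

theorem codeAct_scale {n : ℕ} (a : K) (s : K × OkadaCode n) (i : ℕ) :
    codeAct x y n (a * s.1, s.2) i = (a * (codeAct x y n s i).1, (codeAct x y n s i).2) := by
  induction n generalizing a i with
  | zero => simp [codeAct]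
  | succ n ih =>
    obtain ⟨s, m, rfl⟩ := exists_eq_snocScaled s
    have e : (a * (snocScaled s m).1, (snocScaled s m).2) = snocScaled (a * s.1, s.2) m := rfl
    rw [e]
    rcases lt_trichotomy (i + 1) m with h | rfl | h
    · rw [codeAct_of_lt _ _ _ h, codeAct_of_lt _ _ _ h, ih]; rfl
    · rw [codeAct_of_succ_eq, codeAct_of_succ_eq]; rfl
    · rcases (Nat.lt_succ_iff.1 h).eq_or_lt with rfl | h
      · rw [codeAct_of_eq, codeAct_of_eq, mul_left_comm]; rfl
      · rw [codeAct_of_gt _ _ _ h, codeAct_of_gt _ _ _ h, mul_left_comm]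
        have := foldl_scale_of (fun a s i => ih a s i) (descWord m (i - 1)) a (y (i - 1) * s.1, s.2)
        rw [this]; rfl

theorem foldl_codeAct_scale {n : ℕ} (w : List ℕ) (a : K) (s : K × OkadaCode n) :
    w.foldl (codeAct x y n) (a * s.1, s.2) = (a * (w.foldl (codeAct x y n) s).1,
      (w.foldl (codeAct x y n) s).2) :=
  foldl_scale_of (fun a s i => codeAct_scale x y a s i) w a s

theorem foldl_comm_letter {S : Type*} {f : S → ℕ → S} {w : List ℕ} {i : ℕ}
    (h : ∀ a ∈ w, ∀ s, f (f s i) a = f (f s a) i) (s : S) :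
    w.foldl f (f s i) = f (w.foldl f s) i := by
  induction w generalizing s with
  | nil => rfl
  | cons a w ih =>
    rw [List.foldl_cons, List.foldl_cons, h a (by simp), ih fun b hb => h b (by simp [hb])]

theorem foldl_comm_word {S : Type*} {f : S → ℕ → S} {v w : List ℕ}
    (h : ∀ a ∈ w, ∀ i ∈ v, ∀ s, f (f s i) a = f (f s a) i) (s : S) :
    w.foldl f (v.foldl f s) = v.foldl f (w.foldl f s) := by
  induction v generalizing s with
  | nil => rfl
  | cons i v ih =>
    rw [List.foldl_cons, List.foldl_cons, ih fun a ha b hb => h a ha b (by simp [hb]),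
      foldl_comm_letter fun a ha => h a ha i (by simp)]

/-- The operators `codeAct` satisfy the relations of the Okada algebra. -/
theorem codeAct_relations (n : ℕ) :
    (∀ s i, codeAct x y n (codeAct x y n s i) i =
      (x i * (codeAct x y n s i).1, (codeAct x y n s i).2)) ∧
    (∀ s i j, i + 2 ≤ j → codeAct x y n (codeAct x y n s i) j =
      codeAct x y n (codeAct x y n s j) i) ∧
    (∀ s i, codeAct x y n (codeAct x y n (codeAct x y n s (i + 1)) i) (i + 1) =
      (y i * (codeAct x y n s (i + 1)).1, (codeAct x y n s (i + 1)).2)) := by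
  induction n with
  | zero => simp [codeAct]
  | succ n ih =>
    obtain ⟨idem, comm, shift⟩ := ih
    have comm' : ∀ i a, i + 2 ≤ a ∨ a + 2 ≤ i → ∀ s,
        codeAct x y n (codeAct x y n s i) a = codeAct x y n (codeAct x y n s a) i :=
      fun i a hw s => hw.elim (fun h => comm s i a h) (fun h => (comm s a i h).symm)
    have mk : ∀ (s : K × OkadaCode n) m a, (a * (snocScaled s m).1, (snocScaled s m).2) =
      snocScaled (a * s.1, s.2) m := fun _ _ _ => rfl
    refine ⟨?_, ?_, ?_⟩
    · intro s i
      obtain ⟨s, m, rfl⟩ := exists_eq_snocScaled s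
      rcases lt_trichotomy (i + 1) m with h | rfl | h
      · rw [codeAct_of_lt _ _ _ h, codeAct_of_lt _ _ _ h, idem, mk]
      · rw [codeAct_of_succ_eq, codeAct_of_eq, mk]
      · rcases (Nat.lt_succ_iff.1 h).eq_or_lt with rfl | h
        · rw [codeAct_of_eq, codeAct_of_eq, mk]
        · rw [codeAct_of_gt _ _ _ h, codeAct_of_eq, mk]
    · intro s i j hij
      obtain ⟨s, m, rfl⟩ := exists_eq_snocScaled s
      rcases lt_trichotomy (i + 1) m with h | rfl | h
      · rw [codeAct_of_lt _ _ _ h]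
        rcases lt_trichotomy (j + 1) m with h' | rfl | h'
        · rw [codeAct_of_lt _ _ _ h', codeAct_of_lt _ _ _ h', codeAct_of_lt _ _ _ h,
            comm _ _ _ hij]
        · rw [codeAct_of_succ_eq, codeAct_of_succ_eq, codeAct_of_lt _ _ _ (by omega)]
        · rcases (Nat.lt_succ_iff.1 h').eq_or_lt with rfl | h'
          · rw [codeAct_of_eq, codeAct_of_eq, codeAct_of_lt _ _ _ (by omega), codeAct_scale]
          · rw [codeAct_of_gt _ _ _ h', codeAct_of_gt _ _ _ h', codeAct_of_lt _ _ _ (by omega),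
              ← codeAct_scale, foldl_comm_letter
                (fun a ha => comm' i a (by rw [mem_descWord] at ha; omega))]
      · rw [codeAct_of_succ_eq, codeAct_of_gt _ _ _ (by omega),
          codeAct_of_gt _ _ _ (by omega : i + 1 < j),
          codeAct_of_lt _ _ _ (by omega), descWord_succ (by omega), List.foldl_append]
        rfl
      · rcases (Nat.lt_succ_iff.1 h).eq_or_lt with rfl | h
        · rw [codeAct_of_eq, codeAct_of_gt _ _ _ (by omega), codeAct_of_gt _ _ _ (by omega),
            codeAct_of_lt _ _ _ (by omega), descWord_succ (by omega), List.foldl_append,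
            List.foldl_append, List.foldl_cons, List.foldl_nil, List.foldl_cons, List.foldl_nil,
            idem, mul_left_comm]
          have := foldl_codeAct_scale x y (descWord (m + 1) (j - 1)) (x m) (y (j - 1) * s.1, s.2)
          rw [this, codeAct_scale]
        · rw [codeAct_of_gt _ _ _ h, codeAct_of_gt _ _ _ (by omega),
            codeAct_of_gt _ _ _ (by omega), codeAct_of_lt _ _ _ (by omega)]
          congr 1
          rw [← foldl_codeAct_scale, mul_left_comm]
          -- The essential case `m < i`. In `(j-2) ⋯ m` followed by `i`, the last letter moves left
          -- to form `i (i-1) i`, which the relation of lower rank turns into `y_{i-1} i`. What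
          -- remains is that `(i-2) ⋯ m` commutes with `(j-2) ⋯ i`.
          have e : descWord m (j - 1) =
              descWord (i + 1) (j - 1) ++ [i - 1 + 1] ++ [i - 1] ++ descWord m (i - 1) := by
            rw [← descWord_self_succ (i - 1 + 1), show i - 1 + 1 + 1 = i + 1 by omega,
              descWord_append (by omega) (by omega), ← descWord_self_succ (i - 1),
              descWord_append (by omega) (by omega), descWord_append (by omega) (by omega)]
          have e' : descWord i (j - 1) = descWord (i + 1) (j - 1) ++ [i] :=
            descWord_succ (by omega)
          have h₁ : ∀ s, codeAct x y n ((descWord m (i - 1)).foldl (codeAct x y n) s) i =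
              (descWord m (i - 1)).foldl (codeAct x y n) (codeAct x y n s i) := fun s =>
            (foldl_comm_letter (fun a ha => comm' i a (by rw [mem_descWord] at ha; omega)) s).symm
          have h₂ := shift ((descWord (i + 1) (j - 1)).foldl (codeAct x y n)
            (y (j - 1) * s.1, s.2)) (i - 1)
          have h₃ := foldl_comm_word (f := codeAct x y n) (v := descWord i (j - 1))
            (w := descWord m (i - 1)) (fun a ha b hb => comm' b a (by
              rw [mem_descWord] at ha hb; omega)) (y (i - 1) * (y (j - 1) * s.1), s.2)
          rw [e, List.foldl_append, h₁, ← h₃, e']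
          simp only [List.foldl_append, List.foldl_cons, List.foldl_nil]
          rw [show i - 1 + 1 = i by omega] at h₂ ⊢
          rw [h₂]
          have h₄ := foldl_codeAct_scale x y (descWord (i + 1) (j - 1)) (y (i - 1))
            (y (j - 1) * s.1, s.2)
          rw [h₄, codeAct_scale]
    · intro s i
      obtain ⟨s, m, rfl⟩ := exists_eq_snocScaled s
      rcases lt_trichotomy (i + 1 + 1) m with h | rfl | h
      · rw [codeAct_of_lt _ _ _ h, codeAct_of_lt _ _ _ (by omega), codeAct_of_lt _ _ _ h, shift, mk]
      · rw [codeAct_of_succ_eq, codeAct_of_succ_eq, codeAct_of_gt _ _ _ (by omega),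
          descWord_of_le (by omega)]
        rfl
      · rcases (Nat.lt_succ_iff.1 h).eq_or_lt with rfl | h
        · rw [codeAct_of_eq, codeAct_of_succ_eq, codeAct_of_gt _ _ _ (by omega),
            descWord_of_le (by omega)]
          rfl
        · rw [codeAct_of_gt _ _ _ h, codeAct_of_succ_eq, codeAct_of_gt _ _ _ (by omega),
            descWord_of_le (by omega : i + 1 - 1 ≤ i)]
          rfl

end

namespace OkadaCode

/-- The word of a code. -/
def word : {n : ℕ} → OkadaCode n → List ℕ
  | _, nil => []
  | _, @snoc n u m => word u ++ descWord m (n + 1)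

/-- The entry appended to a code of rank `n` is required to lie in `{1, …, n + 1}`. -/
def Valid : {n : ℕ} → OkadaCode n → Prop
  | _, nil => True
  | _, @snoc n u m => (1 ≤ m ∧ m ≤ n + 1) ∧ Valid u

/-- The code of the empty word. -/
def empty : (n : ℕ) → OkadaCode n
  | 0 => nil
  | n + 1 => snoc (empty n) (n + 1)

theorem word_snoc {n : ℕ} (u : OkadaCode n) (m : ℕ) :
    (u.snoc m).word = u.word ++ descWord m (n + 1) := rfl

theorem valid_snoc {n : ℕ} {u : OkadaCode n} {m : ℕ} :
    (u.snoc m).Valid ↔ (1 ≤ m ∧ m ≤ n + 1) ∧ u.Valid := Iff.rfl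

theorem word_empty (n : ℕ) : (empty n).word = [] := by
  induction n with
  | zero => rfl
  | succ n ih => rw [empty, word_snoc, ih, descWord_of_le le_rfl]; rfl

theorem valid_empty (n : ℕ) : (empty n).Valid := by
  induction n with
  | zero => trivial
  | succ n ih => exact ⟨⟨by omega, le_rfl⟩, ih⟩

theorem mem_word {n : ℕ} {u : OkadaCode n} (hu : u.Valid) {i : ℕ} (hi : i ∈ u.word) :
    1 ≤ i ∧ i < n := by
  induction u with
  | nil => simp [word] at hi
  | @snoc n u m ih =>
    rw [word_snoc, List.mem_append, mem_descWord] at hi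
    rw [valid_snoc] at hu
    rcases hi with hi | hi
    · have := ih hu.2 hi
      omega
    · omega

end OkadaCode

/-- How a step of the action changes the word of a code. -/
structure CodeStep {n : ℕ} (u v : OkadaCode n) (w : List ℕ) : Prop where
  valid : v.Valid
  length_le : v.word.length ≤ u.word.length + w.length
  traceEq : v.word.length = u.word.length + w.length → TraceEq v.word (u.word ++ w)
  length_eq : ReducedWord (u.word ++ w) → v.word.length = u.word.length + w.length

section

variable {K : Type*} [CommRing K] (x y : ℕ → K)

/-- Lengths are subadditive along the word, so equality in total forces equality at each step. The
one-letter case is a hypothesis because its own induction needs this lemma in lower rank. -/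
theorem codeStep_foldl_of {n : ℕ}
    (h : ∀ (s : K × OkadaCode n) (i : ℕ), s.2.Valid → 1 ≤ i → i < n →
      CodeStep s.2 (codeAct x y n s i).2 [i])
    (w : List ℕ) (hw : ∀ i ∈ w, 1 ≤ i ∧ i < n) (s : K × OkadaCode n) (hs : s.2.Valid) :
    CodeStep s.2 (w.foldl (codeAct x y n) s).2 w := by
  induction w generalizing s with
  | nil => exact ⟨hs, by simp, fun _ => by simpa using TraceEq.refl _, fun _ => by simp⟩
  | cons i w ih =>
    have h₁ := h s i hs (hw i (by simp)).1 (hw i (by simp)).2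
    have h₂ := ih (fun j hj => hw j (by simp [hj])) _ h₁.valid
    have l₁ := h₁.length_le
    have l₂ := h₂.length_le
    rw [List.foldl_cons]
    rw [List.length_singleton] at l₁
    refine ⟨h₂.valid, by rw [List.length_cons]; omega, fun e => ?_, fun e => ?_⟩
    · rw [List.length_cons] at e
      have t₁ := h₁.traceEq (by rw [List.length_singleton]; omega)
      have t₂ := h₂.traceEq (by omega)
      have := t₂.trans (t₁.append_right w)
      rwa [List.append_assoc, List.singleton_append] at this
    · have e' : ReducedWord ((s.2.word ++ [i]) ++ w) := by
        rwa [List.append_assoc, List.singleton_append]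
      have k₁ := h₁.length_eq e'.of_append_left
      have k₂ := h₂.length_eq (((h₁.traceEq k₁).symm.append_right w).reducedWord e')
      rw [List.length_singleton] at k₁
      rw [List.length_cons]; omega

/-- The first two cases of the action only commute the letter into place. In the other two the code
gets shorter than required, but then the word is not reduced: the block contains `i`, with only
smaller letters between it and the new `i`. -/
theorem codeStep_codeAct {n : ℕ} (s : K × OkadaCode n) (i : ℕ) (hs : s.2.Valid) (h1 : 1 ≤ i)
    (hi : i < n) : CodeStep s.2 (codeAct x y n s i).2 [i] := by
  induction n generalizing i with
  | zero => omega
  | succ n ih =>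
    obtain ⟨s, m, rfl⟩ := exists_eq_snocScaled s
    have hv : (1 ≤ m ∧ m ≤ n + 1) ∧ s.2.Valid := hs
    rcases lt_trichotomy (i + 1) m with h | rfl | h
    · rw [codeAct_of_lt _ _ _ h]
      simp only [snocScaled]
      have st := ih s i hv.2 h1 (by omega)
      have l₁ := st.length_le
      have hc : TraceEq (descWord m (n + 1) ++ [i]) ([i] ++ descWord m (n + 1)) :=
        TraceEq.append_comm fun a ha b hb => by
          rw [mem_descWord] at ha
          rw [List.mem_singleton] at hb
          omega
      have hc' := hc.append_left s.2.word
      rw [← List.append_assoc, ← List.append_assoc] at hc'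
      refine ⟨⟨hv.1, st.valid⟩, ?_, fun e => ?_, fun e => ?_⟩
      · simp only [OkadaCode.word_snoc, List.length_append] at *
        omega
      · simp only [OkadaCode.word_snoc, List.length_append] at *
        exact ((st.traceEq (by omega)).append_right _).trans hc'.symm
      · have := st.length_eq (hc'.reducedWord e).of_append_left
        simp only [OkadaCode.word_snoc, List.length_append] at *
        omega
    · rw [codeAct_of_succ_eq]
      simp only [snocScaled]
      have e : descWord i (n + 1) = descWord (i + 1) (n + 1) ++ [i] := descWord_succ hi
      refine ⟨⟨⟨h1, by omega⟩, hv.2⟩, ?_, fun _ => ?_, fun _ => ?_⟩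
      · simp [OkadaCode.word_snoc, e]; omega
      · simp [OkadaCode.word_snoc, e, TraceEq.refl]
      · simp [OkadaCode.word_snoc, e]; omega
    · have e : descWord i (n + 1) = descWord (i + 1) (n + 1) ++ [i] := descWord_succ hi
      rcases (Nat.lt_succ_iff.1 h).eq_or_lt with rfl | h
      · rw [codeAct_of_eq]
        simp only [snocScaled]
        refine ⟨⟨hv.1, hv.2⟩, by simp, fun h => by simp at h, fun h => (h m ?_).elim⟩
        rw [OkadaCode.word_snoc, e]
        refine ⟨adjFilter m (s.2.word ++ descWord (m + 1) (n + 1)), [], ?_⟩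
        simp [adjFilter_cons]
      · rw [codeAct_of_gt _ _ _ h]
        simp only [snocScaled]
        have st := codeStep_foldl_of x y (fun s i hs h1 hi => ih s i hs h1 hi)
          (descWord m (i - 1)) (fun j hj => by rw [mem_descWord] at hj; omega)
          (y (i - 1) * s.1, s.2) hv.2
        have l := st.length_le
        -- The block shrinks by `i - m` letters, while at most `i - 1 - m` letters are passed on to
        -- the shorter code.
        have l' : (((descWord m (i - 1)).foldl (codeAct x y n) (y (i - 1) * s.1, s.2)).2.snoc
            i).word.length < (s.2.snoc m).word.length := by
          simp only [OkadaCode.word_snoc, List.length_append, length_descWord] at *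
          omega
        refine ⟨⟨⟨h1, by omega⟩, st.valid⟩, by simp; omega, fun h => by simp at h; omega,
          fun h => (h i ?_).elim⟩
        rw [OkadaCode.word_snoc, ← descWord_append (show m ≤ i by omega) (by omega), e]
        refine ⟨adjFilter i (s.2.word ++ descWord (i + 1) (n + 1)), [], ?_⟩
        have e' : adjFilter i (descWord m i) = [] := adjFilter_eq_nil fun a ha => by
          rw [mem_descWord] at ha; omega
        simp [adjFilter_cons, e']

theorem codeStep_foldl {n : ℕ} (w : List ℕ) (hw : ∀ i ∈ w, 1 ≤ i ∧ i < n)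
    (s : K × OkadaCode n) (hs : s.2.Valid) : CodeStep s.2 (w.foldl (codeAct x y n) s).2 w :=
  codeStep_foldl_of x y (codeStep_codeAct x y) w hw s hs

theorem foldl_codeAct_descWord {n m : ℕ} (s : K × OkadaCode n) (b : ℕ) (h : m ≤ b) :
    (descWord m b).foldl (codeAct x y (n + 1)) (snocScaled s b) = snocScaled s m := by
  induction b with
  | zero => rw [descWord_of_le (by omega), Nat.le_zero.1 h]; rfl
  | succ b ih =>
    rcases h.eq_or_lt with rfl | h
    · rw [descWord_of_le le_rfl]; rfl
    · rw [descWord_succ' (by omega), List.foldl_cons, codeAct_of_succ_eq, ih (by omega)]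

theorem foldl_codeAct_snocScaled {n m : ℕ} (w : List ℕ) (hw : ∀ i ∈ w, i + 1 < m)
    (s : K × OkadaCode n) : w.foldl (codeAct x y (n + 1)) (snocScaled s m) =
      snocScaled (w.foldl (codeAct x y n) s) m := by
  induction w generalizing s with
  | nil => rfl
  | cons i w ih =>
    rw [List.foldl_cons, List.foldl_cons, codeAct_of_lt _ _ _ (hw i (by simp)),
      ih fun j hj => hw j (by simp [hj])]

/-- Along a normal form only the two cases without scalars occur. Hence the code can be recovered
from the product along its word, with coefficient `1` whatever the parameters are. -/
theorem foldl_codeAct_word {n : ℕ} (u : OkadaCode n) (hu : u.Valid) :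
    u.word.foldl (codeAct x y n) (1, OkadaCode.empty n) = (1, u) := by
  induction u with
  | nil => rfl
  | @snoc n u m ih =>
    have e : ((1 : K), OkadaCode.empty (n + 1)) = snocScaled (1, OkadaCode.empty n) (n + 1) := rfl
    rw [OkadaCode.word_snoc, List.foldl_append, e, foldl_codeAct_snocScaled, ih hu.2,
      foldl_codeAct_descWord _ _ _ _ hu.1.2]
    · rfl
    · intro i hi
      have := OkadaCode.mem_word hu.2 hi
      omega

end

/-- Every reduced word is equivalent to the word of a code. -/
theorem ReducedWord.exists_code {n : ℕ} {w : List ℕ} (h : ReducedWord w)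
    (hw : ∀ i ∈ w, 1 ≤ i ∧ i < n) : ∃ u : OkadaCode n, u.Valid ∧ TraceEq w u.word := by
  -- Ring and parameters are arbitrary here; only the resulting code is used.
  have st := codeStep_foldl (K := ℤ) 1 1 w hw (1, OkadaCode.empty n) (OkadaCode.valid_empty n)
  refine ⟨_, st.valid, ?_⟩
  have e := st.length_eq (by simpa [OkadaCode.word_empty] using h)
  simpa [OkadaCode.word_empty] using (st.traceEq e).symm

/-- Only the projections for `i` and `i - 1` change, and in the latter the new letter is the larger
of the two, so it creates no forbidden repetition. -/
theorem ReducedWord.append_singleton {w : List ℕ} (h : ReducedWord w) {i : ℕ}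
    (hi : ¬ [i] <:+ adjFilter i w) : ReducedWord (w ++ [i]) := by
  intro c hc
  rw [adjFilter_append, adjFilter_singleton] at hc
  split_ifs at hc with hic
  · rw [List.infix_concat_iff] at hc
    rcases hc with ⟨t, ht⟩ | hc
    · rw [show t ++ [c, c] = (t ++ [c]) ++ [c] by simp] at ht
      obtain ⟨e, e'⟩ := List.append_inj' ht rfl
      obtain rfl : c = i := by simpa using e'
      exact hi ⟨t, e⟩
    · exact h c hc
  · rw [List.append_nil] at hc
    exact h c hc

/-- Each letter of the block comes right after its successor, except the first letter `n`, which
does not occur in `w`. -/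
theorem ReducedWord.append_descWord {n m : ℕ} {w : List ℕ} (h : ReducedWord w)
    (hw : ∀ i ∈ w, i < n) (hm : m ≤ n + 1) : ReducedWord (w ++ descWord m (n + 1)) := by
  induction hm using Nat.decreasingInduction with
  | self => simpa [descWord_of_le le_rfl] using h
  | of_succ m hm ih =>
    rw [descWord_succ hm, ← List.append_assoc]
    refine ih.append_singleton fun hs => ?_
    rcases (Nat.lt_succ_iff.1 hm).eq_or_lt with rfl | hm'
    · rw [descWord_of_le le_rfl, List.append_nil] at hs
      have := hw _ (mem_adjFilter.1 (hs.mem (List.mem_singleton_self m))).1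
      omega
    · rw [descWord_succ (by omega : m + 1 < n + 1), ← List.append_assoc, adjFilter_append,
        adjFilter_singleton, if_pos (Or.inr rfl)] at hs
      obtain ⟨t, ht⟩ := hs
      have := List.append_inj_right' ht rfl
      simp at this

theorem OkadaCode.reducedWord_word {n : ℕ} {u : OkadaCode n} (hu : u.Valid) :
    ReducedWord u.word := by
  induction u with
  | nil => exact ReducedWord.nil
  | @snoc n u m ih =>
    exact (ih hu.2).append_descWord (fun i hi => (mem_word hu.2 hi).2) hu.1.2

/-! ## Lehmer codes of permutations -/

/-- The code with entries given by the lengths `c 0, …, c (n - 1)` of the descending blocks. -/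
def OkadaCode.ofFun (c : ℕ → ℕ) : (n : ℕ) → OkadaCode n
  | 0 => nil
  | n + 1 => snoc (ofFun c n) (n + 1 - c n)

namespace OkadaCode

theorem ofFun_congr {c c' : ℕ → ℕ} {n : ℕ} (h : ∀ i < n, c i = c' i) :
    ofFun c n = ofFun c' n := by
  induction n with
  | zero => rfl
  | succ n ih => rw [ofFun, ofFun, ih fun i hi => h i (by omega), h n (by omega)]

theorem valid_ofFun {c : ℕ → ℕ} {n : ℕ} (h : ∀ i < n, c i ≤ i) : (ofFun c n).Valid := by
  induction n with
  | zero => trivial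
  | succ n ih =>
    have := h n (by omega)
    exact ⟨by omega, ih fun i hi => h i (by omega)⟩

theorem exists_ofFun {n : ℕ} {u : OkadaCode n} (hu : u.Valid) :
    ∃ c : ℕ → ℕ, (∀ i, c i ≤ i) ∧ ofFun c n = u := by
  induction u with
  | nil => exact ⟨fun _ => 0, fun _ => Nat.zero_le _, rfl⟩
  | @snoc n u m ih =>
    obtain ⟨c, hc, rfl⟩ := ih hu.2
    refine ⟨Function.update c n (n + 1 - m), fun i => ?_, ?_⟩
    · have := hc i
      have := hu.1
      rw [Function.update_apply]
      split_ifs <;> omega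
    · have := hu.1
      rw [ofFun, ofFun_congr (c' := c) fun i hi => Function.update_of_ne (by omega) _ _,
        Function.update_self]
      congr 1
      omega

theorem word_ofFun {c : ℕ → ℕ} {n : ℕ} (h : ∀ i < n, c i ≤ i) : (ofFun c n).word =
    (List.range n).flatMap (fun i => (List.range (c i)).map (fun k => i - k)) := by
  induction n with
  | zero => rfl
  | succ n ih =>
    rw [ofFun, word_snoc, ih fun i hi => h i (by omega), List.range_succ, List.flatMap_append]
    congr 1
    rw [List.flatMap_singleton]
    have key : ∀ k ≤ n, descWord (n + 1 - k) (n + 1) = (List.range k).map (fun k => n - k) := by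
      intro k hk
      induction k with
      | zero => simp [descWord_of_le]
      | succ k ihk =>
        rw [List.range_succ, List.map_append, ← ihk (by omega), descWord_succ (by omega),
          show n + 1 - (k + 1) + 1 = n + 1 - k by omega]
        simp
    exact key _ (h n (by omega))

theorem ofFun_injective {c c' : ℕ → ℕ} {n : ℕ} (h : ∀ i < n, c i ≤ i) (h' : ∀ i < n, c' i ≤ i)
    (e : ofFun c n = ofFun c' n) : ∀ i < n, c i = c' i := by
  induction n with
  | zero => intro i hi; omega
  | succ n ih =>
    rw [ofFun, ofFun, snoc.injEq] at e
    intro i hi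
    have h₁ := h n (by omega)
    have h₂ := h' n (by omega)
    rcases (Nat.lt_succ_iff.1 hi).eq_or_lt with rfl | hi'
    · omega
    · exact ih (fun i hi => h i (by omega)) (fun i hi => h' i (by omega)) e.1 i hi'

end OkadaCode

/-- The code of a permutation, extended by `0`. -/
def permCodeFun {N : ℕ} (σ : Equiv.Perm (Fin N)) (i : ℕ) : ℕ :=
  if h : i < N then permCode σ ⟨i, h⟩ else 0

theorem permCodeFun_le {N : ℕ} (σ : Equiv.Perm (Fin N)) (i : ℕ) : permCodeFun σ i ≤ i := by
  rw [permCodeFun]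
  split_ifs with h
  · exact permCode_le σ ⟨i, h⟩
  · exact Nat.zero_le _

/-- The code of a permutation. -/
def okadaCode {N : ℕ} (σ : Equiv.Perm (Fin N)) : OkadaCode N := OkadaCode.ofFun (permCodeFun σ) N

theorem valid_okadaCode {N : ℕ} (σ : Equiv.Perm (Fin N)) : (okadaCode σ).Valid :=
  OkadaCode.valid_ofFun fun i _ => permCodeFun_le σ i

theorem word_okadaCode {N : ℕ} (σ : Equiv.Perm (Fin N)) : (okadaCode σ).word = permWord σ := by
  rw [okadaCode, OkadaCode.word_ofFun fun i _ => permCodeFun_le σ i, permWord,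
    ← List.map_coe_finRange_eq_range, List.flatMap_map]
  congr 1
  funext i
  simp [permCodeFun]

theorem permLength_eq_length {N : ℕ} (σ : Equiv.Perm (Fin N)) :
    permLength σ = (permWord σ).length := by
  have h : (permWord σ).length = ∑ i : Fin N, permCode σ i := by
    rw [permWord, List.length_flatMap, ← List.ofFn_eq_map, List.sum_ofFn]
    simp
  rw [h, permLength]
  simp only [permCode]
  rw [← Finset.card_sigma]
  refine Finset.card_bij' (fun p _ => ⟨σ p.1, σ p.2⟩) (fun p _ => (σ.symm p.1, σ.symm p.2))
    ?_ ?_ ?_ ?_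
  · simp +contextual
  · simp +contextual
  · simp
  · simp

theorem perm_eq_of_lt_iff {N : ℕ} {π π' : Equiv.Perm (Fin N)}
    (h : ∀ i j, π j < π i ↔ π' j < π' i) : π = π' := by
  have key : ∀ (π : Equiv.Perm (Fin N)) i, (π i : ℕ) = (Finset.univ.filter (π · < π i)).card := by
    intro π i
    rw [← Fin.card_Iio (π i)]
    refine Finset.card_bij' (fun j _ => π.symm j) (fun j _ => π j) ?_ ?_ ?_ ?_ <;> simp
  ext i
  rw [key π, key π']
  simp only [h]

/-- The code determines the relative order of the positions of the first `n` values, by induction on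
`n`. The smaller values placed after the value `i` form an upper set of an already known linear
order, and an upper set of a finite chain is determined by its size, here the code entry. -/
theorem permCode_injective {N : ℕ} {σ σ' : Equiv.Perm (Fin N)}
    (h : ∀ i, permCode σ i = permCode σ' i) : σ = σ' := by
  suffices H : ∀ n : ℕ, ∀ i j : Fin N, (i : ℕ) < n → (j : ℕ) < n →
      (σ.symm j < σ.symm i ↔ σ'.symm j < σ'.symm i) by
    have := perm_eq_of_lt_iff fun i j => H N i j i.2 j.2
    exact Equiv.symm_bijective.1 this
  intro n
  induction n with
  | zero => intro i j hi; omega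
  | succ n ih =>
    have key : ∀ i j : Fin N, (i : ℕ) = n → j < i →
        (σ.symm i < σ.symm j ↔ σ'.symm i < σ'.symm j) := by
      intro i j hi hj
      have hup : ∀ τ : Equiv.Perm (Fin N), ∀ a b : Fin N, b < i → τ.symm a < τ.symm b →
        a ∈ Finset.univ.filter (fun j => j < i ∧ τ.symm i < τ.symm j) →
        b ∈ Finset.univ.filter (fun j => j < i ∧ τ.symm i < τ.symm j) := by
        intro τ a b hb hab ha
        simp only [Finset.mem_filter, Finset.mem_univ, true_and] at ha ⊢
        exact ⟨hb, ha.2.trans hab⟩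
      have hsub : Finset.univ.filter (fun j => j < i ∧ σ.symm i < σ.symm j) =
          Finset.univ.filter (fun j => j < i ∧ σ'.symm i < σ'.symm j) := by
        by_contra hne
        have hc := h i
        rw [permCode, permCode] at hc
        have h₁ : ¬ Finset.univ.filter (fun j => j < i ∧ σ.symm i < σ.symm j) ⊆
            Finset.univ.filter (fun j => j < i ∧ σ'.symm i < σ'.symm j) :=
          fun hs => hne (Finset.eq_of_subset_of_card_le hs hc.ge)
        have h₂ : ¬ Finset.univ.filter (fun j => j < i ∧ σ'.symm i < σ'.symm j) ⊆
            Finset.univ.filter (fun j => j < i ∧ σ.symm i < σ.symm j) :=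
          fun hs => hne (Finset.eq_of_subset_of_card_le hs hc.le).symm
        obtain ⟨a, ha, ha'⟩ := Finset.not_subset.1 h₁
        obtain ⟨b, hb, hb'⟩ := Finset.not_subset.1 h₂
        have hai : a < i := by simp only [Finset.mem_filter] at ha; exact ha.2.1
        have hbi : b < i := by simp only [Finset.mem_filter] at hb; exact hb.2.1
        rcases lt_trichotomy (σ.symm a) (σ.symm b) with hab | hab | hab
        · exact hb' (hup σ a b hbi hab ha)
        · rw [EmbeddingLike.apply_eq_iff_eq] at hab
          exact ha' (hab ▸ hb)
        · exact ha' (hup σ' b a hai ((ih a b (by omega) (by omega)).1 hab) hb)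
      have := Finset.ext_iff.1 hsub j
      simpa [hj] using this
    intro i j hi hj
    rcases lt_trichotomy j i with hji | rfl | hji
    · by_cases hin : (i : ℕ) = n
      · have hne : ∀ τ : Equiv.Perm (Fin N), τ.symm j ≠ τ.symm i := fun τ e =>
          hji.ne (τ.symm.injective e)
        have := key i j hin hji
        have a := hne σ
        have b := hne σ'
        omega
      · exact ih i j (by omega) (by omega)
    · simp
    · by_cases hjn : (j : ℕ) = n
      · exact key j i hjn hji
      · exact ih i j (by omega) (by omega)

theorem okadaCode_injective {N : ℕ} {σ σ' : Equiv.Perm (Fin N)}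
    (h : okadaCode σ = okadaCode σ') : σ = σ' := by
  refine permCode_injective fun i => ?_
  have := OkadaCode.ofFun_injective (fun i _ => permCodeFun_le σ i)
    (fun i _ => permCodeFun_le σ' i) h i i.2
  simpa [permCodeFun] using this

/-- Injectivity and the count `N! = ∏ (i + 1)`. -/
theorem okadaCode_surjective {N : ℕ} {u : OkadaCode N} (hu : u.Valid) :
    ∃ σ : Equiv.Perm (Fin N), okadaCode σ = u := by
  have hb : Function.Bijective (fun (σ : Equiv.Perm (Fin N)) (i : Fin N) =>
      (⟨permCode σ i, Nat.lt_succ_of_le (permCode_le σ i)⟩ : Fin ((i : ℕ) + 1))) := by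
    rw [Fintype.bijective_iff_injective_and_card]
    constructor
    · intro σ σ' h
      exact permCode_injective fun i => by simpa using congrFun h i
    · rw [Fintype.card_perm, Fintype.card_pi]
      simp only [Fintype.card_fin]
      rw [Fin.prod_univ_eq_prod_range (fun i => i + 1), Finset.prod_range_add_one_eq_factorial]
  obtain ⟨c, hc, rfl⟩ := OkadaCode.exists_ofFun hu
  obtain ⟨σ, hσ⟩ := hb.2 fun i => ⟨c i, Nat.lt_succ_of_le (hc i)⟩
  refine ⟨σ, OkadaCode.ofFun_congr fun i hi => ?_⟩
  have := congrFun hσ ⟨i, hi⟩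
  simpa [permCodeFun, hi] using this

theorem reducedWord_permWord {N : ℕ} (σ : Equiv.Perm (Fin N)) : ReducedWord (permWord σ) := by
  rw [← word_okadaCode]
  exact OkadaCode.reducedWord_word (valid_okadaCode σ)

/-- Every reduced word is equivalent to the word of a permutation. -/
theorem ReducedWord.exists_perm {N : ℕ} {w : List ℕ} (h : ReducedWord w)
    (hw : ∀ i ∈ w, 1 ≤ i ∧ i < N) : ∃ σ : Equiv.Perm (Fin N), TraceEq w (permWord σ) := by
  obtain ⟨u, hu, e⟩ := h.exists_code hw
  obtain ⟨σ, rfl⟩ := okadaCode_surjective hu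
  exact ⟨σ, by rwa [word_okadaCode] at e⟩

/-! ## Words in the Okada algebra -/

/-- The operator of a generator on the free module over the codes. -/
noncomputable def codeOp {K : Type*} [CommRing K] (x y : ℕ → K) (n i : ℕ) :
    (OkadaCode n →₀ K) →ₗ[K] (OkadaCode n →₀ K) :=
  Finsupp.linearCombination K
    (fun u => Finsupp.single (codeAct x y n (1, u) i).2 (codeAct x y n (1, u) i).1)

theorem codeOp_single {K : Type*} [CommRing K] (x y : ℕ → K) {n : ℕ} (i : ℕ)
    (s : K × OkadaCode n) : codeOp x y n i (Finsupp.single s.2 s.1) =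
      Finsupp.single (codeAct x y n s i).2 (codeAct x y n s i).1 := by
  have := codeAct_scale x y s.1 (1, s.2) i
  simp only [mul_one, Prod.mk.eta] at this
  rw [codeOp, Finsupp.linearCombination_single, this, Finsupp.smul_single, smul_eq_mul]

section

variable {K : Type*} [Field K] {N : ℕ} (X : Fin (N - 1) → K) (Y : Fin (N - 2) → K)

/-- The parameters `x_i`, extended by `0`. -/
def extendX (i : ℕ) : K := if h : 1 ≤ i ∧ i < N then X ⟨i - 1, by omega⟩ else 0

/-- The parameters `y_i`, extended by `0`. -/
def extendY (i : ℕ) : K := if h : 1 ≤ i ∧ i + 1 < N then Y ⟨i - 1, by omega⟩ else 0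

/-- The right regular representation of the Okada algebra. -/
noncomputable def okadaRep :
    OkadaAlgebra N X Y →ₐ[K] (Module.End K (OkadaCode N →₀ K))ᵐᵒᵖ :=
  RingQuot.liftAlgHom K ⟨FreeAlgebra.lift K
    (fun i : Fin (N - 1) => MulOpposite.op (codeOp (extendX X) (extendY Y) N (i + 1))), by
    obtain ⟨idem, comm, shift⟩ := codeAct_relations (extendX X) (extendY Y) N
    intro a b hab
    cases hab with
    | idem i =>
      simp only [map_mul, map_smul, FreeAlgebra.lift_ι_apply]
      apply MulOpposite.unop_injective
      refine Finsupp.lhom_ext fun u k => ?_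
      have h := codeOp_single (extendX X) (extendY Y) (i + 1) (k, u)
      simp only at h
      have hx : extendX X (i + 1) = X i := by
        rw [extendX, dif_pos (by omega)]; rfl
      simp only [MulOpposite.unop_mul, MulOpposite.unop_op, Module.End.mul_apply,
        MulOpposite.unop_smul, LinearMap.smul_apply, h, codeOp_single, idem, hx,
        Finsupp.smul_single, smul_eq_mul]
    | comm i j hij =>
      simp only [map_mul, FreeAlgebra.lift_ι_apply]
      apply MulOpposite.unop_injective
      refine Finsupp.lhom_ext fun u k => ?_
      have h := fun i => codeOp_single (extendX X) (extendY Y) i (k, u)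
      simp only at h
      simp only [MulOpposite.unop_mul, MulOpposite.unop_op, Module.End.mul_apply, h, codeOp_single,
        comm _ (i + 1 : ℕ) (j + 1) (by omega)]
    | shift i j k hi hj =>
      simp only [map_mul, map_smul, FreeAlgebra.lift_ι_apply]
      apply MulOpposite.unop_injective
      refine Finsupp.lhom_ext fun u a => ?_
      have h := fun i => codeOp_single (extendX X) (extendY Y) i (a, u)
      simp only at h
      have hy : extendY Y (k + 1) = Y k := by
        rw [extendY, dif_pos (by omega)]; rfl
      simp only [MulOpposite.unop_mul, MulOpposite.unop_op, Module.End.mul_apply,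
        MulOpposite.unop_smul, LinearMap.smul_apply, h, codeOp_single, hi, hj, shift, hy,
        Finsupp.smul_single, smul_eq_mul]⟩

/-- The product of the generators along a word. -/
noncomputable def okadaWord (w : List ℕ) : OkadaAlgebra N X Y := (w.map (okadaGen N X Y)).prod

theorem okadaRep_okadaGen {i : ℕ} (hi : 1 ≤ i ∧ i < N) : okadaRep X Y (okadaGen N X Y i) =
    MulOpposite.op (codeOp (extendX X) (extendY Y) N i) := by
  rw [okadaGen, dif_pos hi, okadaRep, RingQuot.liftAlgHom_mkAlgHom_apply,
    FreeAlgebra.lift_ι_apply]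
  congr 2
  simp only
  omega

theorem okadaRep_okadaWord {w : List ℕ} (hw : ∀ i ∈ w, 1 ≤ i ∧ i < N) (s : K × OkadaCode N) :
    (okadaRep X Y (okadaWord X Y w)).unop (Finsupp.single s.2 s.1) =
      Finsupp.single (w.foldl (codeAct (extendX X) (extendY Y) N) s).2
        (w.foldl (codeAct (extendX X) (extendY Y) N) s).1 := by
  induction w generalizing s with
  | nil => simp [okadaWord]
  | cons i w ih =>
    have e : okadaWord X Y (i :: w) = okadaGen N X Y i * okadaWord X Y w := by
      simp [okadaWord]
    rw [e, map_mul, okadaRep_okadaGen X Y (hw i (by simp)), MulOpposite.unop_mul,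
      MulOpposite.unop_op, Module.End.mul_apply, codeOp_single, ih fun j hj => hw j (by simp [hj])]
    rfl

theorem okadaWord_append (u v : List ℕ) :
    okadaWord X Y (u ++ v) = okadaWord X Y u * okadaWord X Y v := by simp [okadaWord]

theorem okadaPerm_eq_okadaWord (σ : Equiv.Perm (Fin N)) :
    okadaPerm N X Y σ = okadaWord X Y (permWord σ) := rfl

theorem okadaGen_commute {i j : ℕ} (h : i + 2 ≤ j) :
    Commute (okadaGen N X Y i) (okadaGen N X Y j) := by
  rw [okadaGen, okadaGen]
  split_ifs with hi hj
  · rw [Commute, SemiconjBy, ← map_mul, ← map_mul]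
    exact RingQuot.mkAlgHom_rel K (OkadaRel.comm _ _ (by simp only; omega))
  · exact Commute.one_right _
  · exact Commute.one_left _
  · exact Commute.one_left _

theorem TraceEq.okadaWord_eq {u v : List ℕ} (h : TraceEq u v) :
    okadaWord X Y u = okadaWord X Y v :=
  h.prod_map_eq _ fun _ _ _ _ hab => okadaGen_commute X Y hab

/-- If `E_σ` is the product along a word of the same length, then the word of `σ` is equivalent to
this word. -/
theorem traceEq_of_okadaPerm_eq {σ : Equiv.Perm (Fin N)} {w : List ℕ}
    (hw : ∀ i ∈ w, 1 ≤ i ∧ i < N) (h : okadaPerm N X Y σ = okadaWord X Y w)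
    (hl : permLength σ = w.length) : TraceEq (permWord σ) w := by
  have hσ := okadaRep_okadaWord X Y (permWord_range σ) (1, OkadaCode.empty N)
  have hw' := okadaRep_okadaWord X Y hw (1, OkadaCode.empty N)
  rw [okadaPerm_eq_okadaWord] at h
  rw [← word_okadaCode] at hσ h
  rw [foldl_codeAct_word _ _ _ (valid_okadaCode σ), h, hw'] at hσ
  have st := codeStep_foldl (extendX X) (extendY Y) w hw (1, OkadaCode.empty N)
    (OkadaCode.valid_empty N)
  -- The vector of `σ` has coefficient `1`, so equality of the vectors forces equality of the codes,
  -- even if some parameters vanish.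
  rcases (Finsupp.single_eq_single_iff _ _ _ _).1 hσ with ⟨e, -⟩ | ⟨-, e⟩
  · have ht := st.traceEq
    rw [e, word_okadaCode, ← permLength_eq_length, OkadaCode.word_empty] at ht
    simpa using ht (by simpa using hl)
  · exact absurd e one_ne_zero

end

/-- One choice of field and parameters suffices, as equivalent words have the same product in every
Okada algebra and the representation recovers the code. -/
theorem permWord_injective {N : ℕ} {σ σ' : Equiv.Perm (Fin N)}
    (h : TraceEq (permWord σ) (permWord σ')) : σ = σ' := by
  have hσ := okadaRep_okadaWord (K := ℚ) 0 0 (permWord_range σ) (1, OkadaCode.empty N)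
  have hσ' := okadaRep_okadaWord (K := ℚ) 0 0 (permWord_range σ') (1, OkadaCode.empty N)
  rw [h.okadaWord_eq, hσ', ← word_okadaCode, ← word_okadaCode,
    foldl_codeAct_word _ _ _ (valid_okadaCode σ), foldl_codeAct_word _ _ _ (valid_okadaCode σ')]
    at hσ
  have := Finsupp.single_left_injective (one_ne_zero (α := ℚ)) hσ
  exact (okadaCode_injective this).symm

/-! ## Fibonacci sets -/

namespace FibonacciSet

variable {N : ℕ}

/-- The number of elements of `S` that are at least `x`. -/
def countGe (S : FibonacciSet N) (x : ℕ) : ℕ := (S.carrier.filter (x ≤ ·)).card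

theorem countGe_zero (S : FibonacciSet N) : S.countGe 0 = S.carrier.card := by
  simp [countGe]

/-- In a decreasing list the entries `≥ x` form an initial segment. -/
theorem le_getElem_iff {l : List ℕ} (hl : l.Pairwise (· > ·)) (x : ℕ) {i : ℕ} (hi : i < l.length) :
    x ≤ l[i] ↔ i < (l.filter (x ≤ ·)).length := by
  induction l generalizing i with
  | nil => simp at hi
  | cons a l ih =>
    rw [List.pairwise_cons] at hl
    by_cases hx : x ≤ a
    · rw [List.filter_cons_of_pos (by simpa using hx)]
      cases i with
      | zero => simp [hx]
      | succ i =>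
        rw [List.getElem_cons_succ, ih hl.2, List.length_cons]
        omega
    · have hnil : l.filter (x ≤ ·) = [] := by
        rw [List.filter_eq_nil_iff]
        intro b hb
        have := hl.1 b hb
        simp only [decide_eq_true_eq]
        omega
      rw [List.filter_cons_of_neg (by simpa using hx), hnil]
      have : (a :: l)[i] ≤ a := by
        rcases List.mem_cons.1 (List.getElem_mem hi) with h | h
        · exact h.le
        · exact (hl.1 _ h).le
      simp
      omega

theorem countGe_eq_length (S : FibonacciSet N) (x : ℕ) :
    S.countGe x = (S.desc.filter (x ≤ ·)).length := by
  have hn : (S.desc.filter (x ≤ ·)).Nodup := (S.carrier.sort_nodup _).filter _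
  rw [countGe, ← List.toFinset_card_of_nodup hn, List.toFinset_filter, desc,
    Finset.sort_toFinset]
  simp

theorem le_desc_iff (S : FibonacciSet N) (x : ℕ) {i : ℕ} (hi : i < S.carrier.card) :
    x ≤ S.desc.getD i 0 ↔ i < S.countGe x := by
  have hi' : i < S.desc.length := by rwa [length_desc]
  rw [List.getD_eq_getElem _ _ hi', countGe_eq_length]
  refine le_getElem_iff ?_ x hi'
  have h₁ : S.desc.Pairwise (fun a b => a ≥ b) := S.carrier.pairwise_sort _
  have h₂ : S.desc.Nodup := S.carrier.sort_nodup _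
  exact (h₁.and h₂).imp fun h => lt_of_le_of_ne h.1 h.2.symm

theorem countGe_le_card (S : FibonacciSet N) (x : ℕ) : S.countGe x ≤ S.carrier.card :=
  Finset.card_filter_le _ _

/-- Since the entries are compared from the largest down, dominance is the pointwise order of the
counting functions. Infima and label counts are both handled in this form. -/
theorem le_iff_countGe {S T : FibonacciSet N} : S ≤ T ↔ ∀ x, S.countGe x ≤ T.countGe x := by
  constructor
  · rintro ⟨hc, h⟩ x
    by_contra hlt
    have hS := S.countGe_le_card x
    have h₁ := (S.le_desc_iff x (i := S.countGe x - 1) (by omega)).2 (by omega)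
    have h₂ := (T.le_desc_iff x (i := S.countGe x - 1) (by omega)).1
      (h₁.trans (h _ (by omega)))
    omega
  · intro h
    have hc : S.carrier.card ≤ T.carrier.card := by
      rw [← countGe_zero, ← countGe_zero]; exact h 0
    refine ⟨hc, fun i hi => ?_⟩
    rw [le_desc_iff _ _ (by omega)]
    exact ((S.le_desc_iff _ hi).1 le_rfl).trans_le (h _)

theorem countGe_eq (S : FibonacciSet N) (x : ℕ) :
    S.countGe x = S.countGe (x + 1) + if x ∈ S.carrier then 1 else 0 := by
  have : S.carrier.filter (x ≤ ·) =
      S.carrier.filter (x + 1 ≤ ·) ∪ S.carrier.filter (· = x) := by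
    ext y; simp only [Finset.mem_union, Finset.mem_filter]
    constructor
    · rintro ⟨h, h'⟩
      rcases h'.eq_or_lt with rfl | h'
      · exact Or.inr ⟨h, rfl⟩
      · exact Or.inl ⟨h, h'⟩
    · rintro (⟨h, h'⟩ | ⟨h, h'⟩)
      · exact ⟨h, by omega⟩
      · exact ⟨h, by omega⟩
  rw [countGe, this, Finset.card_union_of_disjoint]
  · rw [countGe, Finset.filter_eq']
    split_ifs <;> simp
  · rw [Finset.disjoint_filter]
    intro y _ h; omega

theorem card_filter_le_add_countGe (S : FibonacciSet N) (x : ℕ) :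
    (S.carrier.filter (· ≤ x)).card + S.countGe (x + 1) = S.carrier.card := by
  rw [countGe, ← Finset.card_filter_add_card_filter_not (s := S.carrier) (· ≤ x)]
  simp only [not_le, Nat.lt_iff_add_one_le]

/-- Counting from the top removes any reference to the elements below `s`; this form of the parity
condition behaves well under minima and changes of rank. -/
theorem countGe_parity (S : FibonacciSet N) {s : ℕ} (hs : s ∈ S.carrier) :
    s + S.countGe (s + 1) ≡ N [MOD 2] := by
  have h₁ := S.elem_parity s hs
  have h₂ := S.card_parity
  have h₃ := S.card_filter_le_add_countGe s
  rw [Nat.ModEq] at *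
  omega

theorem countGe_eq_zero (S : FibonacciSet N) {x : ℕ} (hx : N < x) : S.countGe x = 0 := by
  rw [countGe, Finset.card_eq_zero, Finset.filter_eq_empty_iff]
  intro y hy
  have := Finset.mem_Icc.1 (S.subset_Icc hy)
  omega

theorem countGe_one (S : FibonacciSet N) : S.countGe 1 = S.carrier.card := by
  rw [← countGe_zero, countGe_eq S 0, if_neg, add_zero]
  intro h
  have := Finset.mem_Icc.1 (S.subset_Icc h)
  omega

/-- A Fibonacci set, specified by the parities of the numbers of larger elements. -/
def ofCountParity (C : Finset ℕ) (h : C ⊆ Finset.Icc 1 N) (h' : C.card ≡ N [MOD 2])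
    (h'' : ∀ s ∈ C, s + (C.filter (s + 1 ≤ ·)).card ≡ N [MOD 2]) : FibonacciSet N where
  carrier := C
  subset_Icc := h
  card_parity := h'
  elem_parity s hs := by
    have h₁ := h'' s hs
    have h₂ := Finset.card_filter_add_card_filter_not (s := C) (· ≤ s)
    simp only [not_le, Nat.lt_iff_add_one_le] at h₂
    rw [Nat.ModEq] at *
    omega

/-! ### Infima of Fibonacci sets. -/

/-- The minimum of the counting functions of two Fibonacci sets. -/
def minCount (A B : FibonacciSet N) (x : ℕ) : ℕ := min (A.countGe x) (B.countGe x)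

/-- The set whose counting function is the minimum of two counting functions. -/
def infSet (A B : FibonacciSet N) : Finset ℕ :=
  (Finset.Icc 1 N).filter (fun x => minCount A B x = minCount A B (x + 1) + 1)

/-- Both counting functions vanish beyond `N` and decrease by at most one at each step, hence so
does their minimum, which is therefore again a counting function. -/
theorem card_filter_infSet (A B : FibonacciSet N) (x : ℕ) (hx : 1 ≤ x) :
    ((infSet A B).filter (x ≤ ·)).card = minCount A B x := by
  by_cases hN : N < x
  · rw [minCount, countGe_eq_zero _ hN, countGe_eq_zero _ hN, min_self, Finset.card_eq_zero,
      Finset.filter_eq_empty_iff]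
    intro y hy
    have := Finset.mem_Icc.1 (Finset.mem_filter.1 hy).1
    omega
  · have hN' : x ≤ N + 1 := by omega
    clear hN
    induction hN' using Nat.decreasingInduction with
    | self =>
      rw [minCount, countGe_eq_zero _ (by omega), countGe_eq_zero _ (by omega), min_self,
        Finset.card_eq_zero, Finset.filter_eq_empty_iff]
      intro y hy
      have := Finset.mem_Icc.1 (Finset.mem_filter.1 hy).1
      omega
    | of_succ x hxN ih =>
      have ih := ih (by omega)
      have hd : (infSet A B).filter (x ≤ ·) =
          (infSet A B).filter (x + 1 ≤ ·) ∪ (infSet A B).filter (· = x) := by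
        ext y
        rw [Finset.mem_union, Finset.mem_filter, Finset.mem_filter, Finset.mem_filter,
          ← and_or_left]
        exact and_congr_right fun _ => by omega
      rw [hd, Finset.card_union_of_disjoint, ih, Finset.filter_eq']
      · have hA := A.countGe_eq x
        have hB := B.countGe_eq x
        split_ifs with h
        · rw [Finset.card_singleton]
          exact (Finset.mem_filter.1 h).2.symm
        · have h' : ¬ minCount A B x = minCount A B (x + 1) + 1 := fun e =>
            h (Finset.mem_filter.2 ⟨Finset.mem_Icc.2 ⟨hx, by omega⟩, e⟩)
          rw [Finset.card_empty]
          simp only [minCount] at *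
          split_ifs at hA hB <;> omega
      · rw [Finset.disjoint_filter]
        intro y _ h; omega

/-- The infimum of two Fibonacci sets. -/
def inf (A B : FibonacciSet N) : FibonacciSet N :=
  ofCountParity (infSet A B) (Finset.filter_subset _ _)
    (by
      have h := card_filter_infSet A B 1 le_rfl
      rw [Finset.filter_true_of_mem, minCount, countGe_one, countGe_one] at h
      · rw [h]
        rcases min_choice A.carrier.card B.carrier.card with e | e <;> rw [e]
        · exact A.card_parity
        · exact B.card_parity
      · intro y hy
        exact (Finset.mem_Icc.1 (Finset.mem_filter.1 hy).1).1)
    (by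
      intro s hs
      rw [card_filter_infSet A B (s + 1) (by omega)]
      -- If the minimum drops at `s`, then a set that realizes the minimum at `s + 1` contains `s`,
      -- and its parity condition is the one required.
      have h := (Finset.mem_filter.1 hs).2
      have hA := A.countGe_eq s
      have hB := B.countGe_eq s
      have pA := A.countGe_parity (s := s)
      have pB := B.countGe_parity (s := s)
      simp only [minCount, Nat.ModEq] at *
      by_cases h₁ : s ∈ A.carrier <;> by_cases h₂ : s ∈ B.carrier <;> simp only [h₁, h₂,
        if_true, if_false, true_imp_iff] at hA hB pA pB <;> omega)

theorem countGe_inf (A B : FibonacciSet N) {x : ℕ} (hx : 1 ≤ x) :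
    (inf A B).countGe x = min (A.countGe x) (B.countGe x) := card_filter_infSet A B x hx

theorem le_iff_countGe' {S T : FibonacciSet N} :
    S ≤ T ↔ ∀ x, 1 ≤ x → S.countGe x ≤ T.countGe x := by
  rw [le_iff_countGe]
  refine ⟨fun h x _ => h x, fun h x => ?_⟩
  rcases Nat.eq_zero_or_pos x with rfl | hx
  · rw [countGe_zero, countGe_zero, ← countGe_one, ← countGe_one]
    exact h 1 le_rfl
  · exact h x hx

theorem isGLB_inf (A B : FibonacciSet N) : IsGLB {A, B} (inf A B) := by
  constructor
  · rintro C (rfl | rfl)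
    · exact le_iff_countGe'.2 fun x hx => by rw [countGe_inf _ _ hx]; exact min_le_left _ _
    · exact le_iff_countGe'.2 fun x hx => by rw [countGe_inf _ _ hx]; exact min_le_right _ _
  · intro C hC
    have h₁ := le_iff_countGe.1 (hC (Set.mem_insert A {B}))
    have h₂ := le_iff_countGe.1 (hC (Set.mem_insert_of_mem A rfl))
    exact le_iff_countGe'.2 fun x hx => by rw [countGe_inf _ _ hx]; exact le_min (h₁ x) (h₂ x)

/-! ### Gaps and free sets. -/

/-- The largest element of `S` below `i`, or `0`. -/
def prev (S : FibonacciSet N) (i : ℕ) : ℕ := (S.carrier.filter (fun s => s < i)).sup id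

theorem mem_freeSet {S : FibonacciSet N} {i : ℕ} :
    i ∈ S.freeSet ↔ (1 ≤ i ∧ i ≤ N) ∧ i ∉ S.carrier ∧ Odd (i - S.prev i) := by
  rw [freeSet, Finset.mem_filter, Finset.mem_Icc, prev]

theorem prev_lt (S : FibonacciSet N) {i : ℕ} (hi : 1 ≤ i) : S.prev i < i := by
  rw [prev, Finset.sup_lt_iff (Nat.lt_of_succ_le hi)]
  intro s hs
  exact (Finset.mem_filter.1 hs).2

theorem prev_succ (S : FibonacciSet N) (i : ℕ) :
    S.prev (i + 1) = if i ∈ S.carrier then i else S.prev i := by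
  rw [prev]
  split_ifs with h
  · refine le_antisymm (Finset.sup_le fun s hs => ?_) ?_
    · have := (Finset.mem_filter.1 hs).2
      simp only [id]; omega
    · exact Finset.le_sup (f := id) (Finset.mem_filter.2 ⟨h, by omega⟩)
  · rw [prev]
    congr 1
    refine Finset.filter_congr fun s hs => ?_
    have : s ≠ i := fun e => h (e ▸ hs)
    omega

/-- With `countGe_parity` this shows that all gaps of `S` in `{1, …, N}` have even length, the last
one included. The free elements are the first, third, … elements of each gap, so the complement of
`S` is tiled by the pairs `{i, i + 1}` with `i` free. -/
theorem prev_parity (S : FibonacciSet N) (i : ℕ) : S.prev i + S.countGe i ≡ N [MOD 2] := by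
  induction i with
  | zero =>
    have : S.prev 0 = 0 := by simp [prev]
    rw [this, countGe_zero, zero_add]
    exact S.card_parity
  | succ i ih =>
    rw [prev_succ]
    split_ifs with h
    · exact S.countGe_parity h
    · rwa [countGe_eq, if_neg h] at ih

theorem succ_notMem_freeSet {S : FibonacciSet N} {i : ℕ} (h : i ∈ S.freeSet) :
    i + 1 ∉ S.freeSet := by
  rw [mem_freeSet] at h ⊢
  rintro ⟨-, -, h'⟩
  rw [prev_succ, if_neg h.2.1] at h'
  have := S.prev_lt h.1.1
  have h := h.2.2
  rw [Nat.odd_iff] at h h'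
  omega

theorem lt_of_mem_freeSet {S : FibonacciSet N} {i : ℕ} (h : i ∈ S.freeSet) : i < N := by
  rw [mem_freeSet] at h
  by_contra hi
  obtain rfl : i = N := by omega
  have h₁ := S.prev_parity (i + 1)
  rw [countGe_eq_zero _ (by omega), prev_succ, if_neg h.2.1, Nat.ModEq] at h₁
  have := S.prev_lt h.1.1
  have h := h.2.2
  rw [Nat.odd_iff] at h
  omega

theorem succ_notMem_of_mem_freeSet {S : FibonacciSet N} {i : ℕ} (h : i ∈ S.freeSet) :
    i + 1 ∉ S.carrier := by
  intro h'
  rw [mem_freeSet] at h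
  have h₁ := S.prev_parity (i + 1)
  have h₂ := S.countGe_parity h'
  rw [countGe_eq _ (i + 1), if_pos h', prev_succ, if_neg h.2.1] at h₁
  have := S.prev_lt h.1.1
  have h := h.2.2
  rw [Nat.odd_iff] at h
  rw [Nat.ModEq] at h₁ h₂
  omega

theorem pred_mem_freeSet {S : FibonacciSet N} {i : ℕ} (h1 : 1 ≤ i) (hN : i ≤ N)
    (h : i ∉ S.carrier) (h' : i ∉ S.freeSet) : ∃ j ∈ S.freeSet, j + 1 = i := by
  obtain ⟨j, rfl⟩ : ∃ j, i = j + 1 := ⟨i - 1, by omega⟩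
  rw [mem_freeSet] at h'
  have h'' : ¬ Odd (j + 1 - S.prev (j + 1)) := fun e => h' ⟨⟨h1, hN⟩, h, e⟩
  have hlt := S.prev_lt h1
  rw [Nat.odd_iff] at h''
  rw [prev_succ] at h'' hlt
  have hj : j ∉ S.carrier := by
    intro hj
    rw [if_pos hj] at h''
    omega
  rw [if_neg hj] at h'' hlt
  refine ⟨j, mem_freeSet.2 ⟨⟨by omega, by omega⟩, hj, ?_⟩, rfl⟩
  rw [Nat.odd_iff]
  omega

/-! ### Changes of rank. -/

/-- Adds `N + 1` to a Fibonacci set of rank `N`. -/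
def insertTop (S : FibonacciSet N) : FibonacciSet (N + 1) :=
  ofCountParity (insert (N + 1) S.carrier)
    (by
      intro x hx
      rw [Finset.mem_Icc]
      rcases Finset.mem_insert.1 hx with rfl | hx
      · omega
      · have := Finset.mem_Icc.1 (S.subset_Icc hx)
        omega)
    (by
      rw [Finset.card_insert_of_notMem fun h => by
        have := Finset.mem_Icc.1 (S.subset_Icc h); omega]
      exact S.card_parity.add_right 1)
    (by
      intro s hs
      rw [Finset.filter_insert]
      rcases Finset.mem_insert.1 hs with rfl | hs
      · have e := S.countGe_eq_zero (x := N + 1 + 1) (by omega)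
        rw [countGe] at e
        rw [if_neg (by omega), e]
      · have := Finset.mem_Icc.1 (S.subset_Icc hs)
        rw [if_pos (by omega), Finset.card_insert_of_notMem fun h => by
          have := Finset.mem_Icc.1 (S.subset_Icc (Finset.mem_filter.1 h).1); omega]
        exact (S.countGe_parity hs).add_right 1)

/-- A Fibonacci set of rank `N`, regarded as one of rank `N + 2`. -/
def lift (S : FibonacciSet N) : FibonacciSet (N + 2) :=
  ofCountParity S.carrier (S.subset_Icc.trans (Finset.Icc_subset_Icc_right (by omega)))
    (S.card_parity.trans (by rw [Nat.ModEq]; omega))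
    (fun s hs => (S.countGe_parity hs).trans (by rw [Nat.ModEq]; omega))

theorem freeSet_insertTop (S : FibonacciSet N) : S.insertTop.freeSet = S.freeSet := by
  have hp : ∀ i ≤ N + 1, S.insertTop.prev i = S.prev i := by
    intro i hi
    rw [prev, prev]
    congr 1
    exact (Finset.filter_insert _ _ _).trans (if_neg (by omega))
  ext i
  have hc : i ∈ S.insertTop.carrier ↔ i = N + 1 ∨ i ∈ S.carrier := Finset.mem_insert
  rw [mem_freeSet, mem_freeSet, hc]
  constructor
  · rintro ⟨h, h', h''⟩
    push Not at h'
    rw [hp i (by omega)] at h''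
    exact ⟨by omega, h'.2, h''⟩
  · rintro ⟨h, h', h''⟩
    rw [hp i (by omega)]
    exact ⟨by omega, by push Not; exact ⟨by omega, h'⟩, h''⟩

/-- The last gap has even length, so lengthening it by `{N + 1, N + 2}` adds one tile. -/
theorem freeSet_lift (S : FibonacciSet N) : S.lift.freeSet = insert (N + 1) S.freeSet := by
  have hp : ∀ i, S.lift.prev i = S.prev i := fun i => rfl
  have hc : S.lift.carrier = S.carrier := rfl
  have hn : N + 1 ∉ S.carrier := fun h => by
    have := Finset.mem_Icc.1 (S.subset_Icc h); omega
  have hn' : N + 2 ∉ S.carrier := fun h => by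
    have := Finset.mem_Icc.1 (S.subset_Icc h); omega
  have h₁ := S.prev_parity (N + 1)
  have h₂ := S.prev_lt (i := N + 1) (by omega)
  rw [countGe_eq_zero _ (by omega), Nat.ModEq] at h₁
  ext i
  rw [Finset.mem_insert, mem_freeSet, mem_freeSet, hp, hc]
  constructor
  · rintro ⟨h, h', h''⟩
    by_cases hi : i ≤ N
    · exact Or.inr ⟨by omega, h', h''⟩
    · by_cases hi' : i = N + 1
      · exact Or.inl hi'
      · obtain rfl : i = N + 2 := by omega
        rw [prev_succ, if_neg hn, Nat.odd_iff] at h''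
        omega
  · rintro (rfl | ⟨h, h', h''⟩)
    · exact ⟨by omega, hn, by rw [Nat.odd_iff]; omega⟩
    · exact ⟨by omega, h', h''⟩

/-- The word of the free element. -/
def freeWord (S : FibonacciSet N) : List ℕ := S.freeSet.sort (fun a b => a ≤ b)

theorem mem_freeWord {S : FibonacciSet N} {i : ℕ} : i ∈ S.freeWord ↔ i ∈ S.freeSet :=
  Finset.mem_sort _

theorem freeWord_insertTop (S : FibonacciSet N) : S.insertTop.freeWord = S.freeWord := by
  rw [freeWord, freeSet_insertTop, freeWord]

theorem freeWord_lift (S : FibonacciSet N) : S.lift.freeWord = S.freeWord ++ [N + 1] := by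
  have hn : N + 1 ∉ S.freeSet := fun h => by have := lt_of_mem_freeSet h; omega
  rw [freeWord, freeSet_lift]
  refine List.Perm.eq_of_pairwise' (r := (· ≤ ·)) (Finset.pairwise_sort _ _) ?_ ?_
  · rw [List.pairwise_append]
    refine ⟨Finset.pairwise_sort _ _, by simp, fun a ha b hb => ?_⟩
    have := lt_of_mem_freeSet (mem_freeWord.1 ha)
    rw [List.mem_singleton] at hb
    omega
  · rw [List.perm_ext_iff_of_nodup (Finset.sort_nodup _ _)]
    · intro a
      rw [Finset.mem_sort, Finset.mem_insert, List.mem_append, mem_freeWord, List.mem_singleton,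
        or_comm]
    · rw [List.nodup_append]
      refine ⟨Finset.sort_nodup _ _, by simp, fun a ha b hb e => ?_⟩
      rw [List.mem_singleton] at hb
      exact hn (hb ▸ e ▸ mem_freeWord.1 ha)

end FibonacciSet

/-! ## Factorization of reduced words -/

/-- A factorization of the word `w` through the free element of `S`, in which the letters of `w`
that are adjacent to the cut between `ρ` and `τ` all belong to the free element. -/
structure TriangularWord (N : ℕ) (w : List ℕ) (S : FibonacciSet N) (ρ τ : List ℕ) : Prop where
  traceEq : TraceEq w (ρ ++ S.freeWord ++ τ)
  left : ∀ c, c ∉ S.freeSet → c + 1 ∉ S.freeSet → ¬ [c] <:+ adjFilter c ρ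
  right : ∀ c, c ∉ S.freeSet → c + 1 ∉ S.freeSet → ¬ [c] <+: adjFilter c τ

/-- In a descending block that reaches `c + 1`, that letter precedes `c`. -/
theorem not_prefix_adjFilter_descWord {a b c : ℕ} (h : c + 1 < b) :
    ¬ [c] <+: adjFilter c (descWord a b) := by
  intro hp
  have hc : c ∈ descWord a b := (mem_adjFilter.1 (hp.mem (List.mem_singleton_self c))).1
  rw [mem_descWord] at hc
  have e : adjFilter c (descWord (c + 2) b) = [] := adjFilter_eq_nil fun i hi => by
    rw [mem_descWord] at hi; omega
  rw [← descWord_append (show a ≤ c + 1 + 1 by omega) (by omega), adjFilter_append, e,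
    List.nil_append, descWord_succ' (by omega), adjFilter_cons, if_pos (Or.inr rfl),
    List.cons_prefix_cons] at hp
  omega

theorem not_prefix_append {c : ℕ} {u v : List ℕ} (hu : ¬ [c] <+: u) (hv : ¬ [c] <+: v) :
    ¬ [c] <+: u ++ v := by
  cases u with
  | nil => simpa using hv
  | cons a u => simpa using hu

theorem not_suffix_append {c : ℕ} {u v : List ℕ} (hu : ¬ [c] <:+ u) (hv : ¬ [c] <:+ v) :
    ¬ [c] <:+ u ++ v := by
  rw [← List.reverse_prefix] at hu hv ⊢
  rw [List.reverse_append]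
  exact not_prefix_append hv hu

theorem adjFilter_eq_nil_of_lt {c : ℕ} {u : List ℕ} (h : ∀ a ∈ u, a < c) : adjFilter c u = [] :=
  adjFilter_eq_nil fun a ha => by have := h a ha; omega

/-- Induction on the rank. If the top letter is absent, the rank drops by one and the top node is
added to `S`. If it is present, the rank drops by two and the top letter becomes free. -/
theorem ReducedWord.exists_triangularWord {N : ℕ} {w : List ℕ} (h : ReducedWord w)
    (hw : ∀ i ∈ w, 1 ≤ i ∧ i < N) :
    ∃ (S : FibonacciSet N) (ρ τ : List ℕ), TriangularWord N w S ρ τ := by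
  induction N using Nat.strong_induction_on generalizing w with
  | _ N ih =>
  match N, ih with
  | 0, _ =>
    have : w = [] := List.eq_nil_iff_forall_not_mem.2 fun i hi => by have := hw i hi; omega
    subst this
    refine ⟨FibonacciSet.ofCountParity ∅ (by simp) rfl (by simp), [], [], ⟨?_, ?_, ?_⟩⟩
    · simp [FibonacciSet.freeWord, FibonacciSet.freeSet, TraceEq.refl]
    · simp
    · simp
  | N + 1, ih =>
    by_cases hN : N ∈ w
    · obtain ⟨k, rfl⟩ : ∃ k, N = k + 1 := ⟨N - 1, by have := hw N hN; omega⟩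
      obtain ⟨⟨⟩ | ⟨u, m⟩, hu, hwu⟩ := h.exists_code hw
      have hu' := hu.2
      -- The normal form of the reversed word splits an ascending block off the left end of `u`.
      have hr : ReducedWord u.word.reverse := (OkadaCode.reducedWord_word hu').reverse
      obtain ⟨⟨⟩ | ⟨v, m'⟩, hv, huv⟩ := hr.exists_code (n := k + 1) fun i hi =>
        OkadaCode.mem_word hu' (List.mem_reverse.1 hi)
      have hm : m ≤ k + 1 := by
        have := (hwu.mem_iff _).1 hN
        rw [OkadaCode.word_snoc, List.mem_append, mem_descWord] at this
        rcases this with h | h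
        · have := OkadaCode.mem_word hu' h
          omega
        · omega
      have hvk : ∀ i ∈ v.word.reverse, 1 ≤ i ∧ i < k := fun i hi =>
        OkadaCode.mem_word hv.2 (List.mem_reverse.1 hi)
      obtain ⟨S, ρ, τ, hS⟩ := ih k (by omega) (OkadaCode.reducedWord_word hv.2).reverse hvk
      have hmem := fun i => hS.traceEq.mem_iff i
      have hρ : ∀ i ∈ ρ, i < k := fun i hi => (hvk i ((hmem i).2 (by simp [hi]))).2
      have hτ : ∀ i ∈ τ, i < k := fun i hi => (hvk i ((hmem i).2 (by simp [hi]))).2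
      -- At this point `w` is equivalent to `m' ⋯ k`, then the reversed word of `v`, then `(k+1) k ⋯
      -- m`. The letter `k + 1` commutes with `τ`, whose letters are below `k`, and so reaches the
      -- free word.
      refine ⟨S.lift, (descWord m' (k + 1)).reverse ++ ρ, τ ++ descWord m (k + 1), ?_, ?_, ?_⟩
      · have t₁ : TraceEq u.word ((descWord m' (k + 1)).reverse ++ v.word.reverse) := by
          simpa [OkadaCode.word_snoc] using huv.reverse
        have t₂ : TraceEq (τ ++ [k + 1]) ([k + 1] ++ τ) := TraceEq.append_comm fun a ha b hb => by
          have := hτ a ha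
          rw [List.mem_singleton] at hb
          omega
        rw [OkadaCode.word_snoc, descWord_succ' hm] at hwu
        refine hwu.trans ((t₁.append_right _).trans ?_)
        have t₃ := (hS.traceEq.append_left (descWord m' (k + 1)).reverse).append_right
          ((k + 1) :: descWord m (k + 1))
        refine t₃.trans ?_
        have t₄ := (t₂.append_left ((descWord m' (k + 1)).reverse ++ ρ ++ S.freeWord)).append_right
          (descWord m (k + 1))
        rw [FibonacciSet.freeWord_lift]
        simpa using t₄
      · intro c hc hc'
        rw [FibonacciSet.freeSet_lift, Finset.mem_insert, not_or] at hc hc'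
        rw [adjFilter_append]
        by_cases hck : c < k
        · refine not_suffix_append ?_ (hS.left c hc.2 hc'.2)
          rw [← List.reverse_prefix, adjFilter_reverse, List.reverse_reverse]
          exact not_prefix_adjFilter_descWord (by omega)
        -- As `k + 1` is free, `c` is neither `k` nor `k + 1`, so all letters are below `c`.
        · rw [adjFilter_eq_nil_of_lt fun i hi => (hρ i hi).trans_le (by omega),
            adjFilter_eq_nil_of_lt fun i hi => by
              rw [List.mem_reverse, mem_descWord] at hi; omega]
          simp
      · intro c hc hc'
        rw [FibonacciSet.freeSet_lift, Finset.mem_insert, not_or] at hc hc'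
        rw [adjFilter_append]
        by_cases hck : c < k
        · exact not_prefix_append (hS.right c hc.2 hc'.2)
            (not_prefix_adjFilter_descWord (by omega))
        · rw [adjFilter_eq_nil_of_lt fun i hi => (hτ i hi).trans_le (by omega),
            adjFilter_eq_nil_of_lt fun i hi => by
              rw [mem_descWord] at hi; omega]
          simp
    · obtain ⟨S, ρ, τ, hS⟩ := ih N (by omega) h fun i hi => by
        have := hw i hi
        have : i ≠ N := fun e => hN (e ▸ hi)
        omega
      refine ⟨S.insertTop, ρ, τ, ?_, ?_, ?_⟩
      · rw [FibonacciSet.freeWord_insertTop]; exact hS.traceEq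
      · rw [FibonacciSet.freeSet_insertTop]; exact hS.left
      · rw [FibonacciSet.freeSet_insertTop]; exact hS.right

theorem FibonacciSet.adjFilter_freeWord {N : ℕ} (S : FibonacciSet N) (c : ℕ) :
    adjFilter c S.freeWord =
      if c ∈ S.freeSet then [c] else if c + 1 ∈ S.freeSet then [c + 1] else [] := by
  have hn : (adjFilter c S.freeWord).Nodup := (Finset.sort_nodup _ _).filter _
  have hs := @succ_notMem_freeSet N S c
  have key : ∀ a, (∀ x, x ∈ adjFilter c S.freeWord ↔ x = a) → adjFilter c S.freeWord = [a] := by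
    intro a ha
    rw [← List.perm_singleton, List.perm_ext_iff_of_nodup hn (List.nodup_singleton a)]
    simpa using ha
  split_ifs with h h'
  · refine key _ fun x => ?_
    rw [mem_adjFilter, mem_freeWord]
    constructor
    · rintro ⟨hx, rfl | rfl⟩
      · rfl
      · exact (hs h hx).elim
    · rintro rfl
      exact ⟨h, Or.inl rfl⟩
  · refine key _ fun x => ?_
    rw [mem_adjFilter, mem_freeWord]
    constructor
    · rintro ⟨hx, rfl | rfl⟩
      · exact (h hx).elim
      · rfl
    · rintro rfl
      exact ⟨h', Or.inr rfl⟩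
  · refine adjFilter_eq_nil fun x hx => ?_
    rw [mem_freeWord] at hx
    exact ⟨fun e => h (e ▸ hx), fun e => h' (e ▸ hx)⟩

/-- The letters `c` and `c + 1` in front of the cut are determined by the number of letters
`c + 1`. -/
theorem eq_of_append_eq_append {c : ℕ} {a b f s t : List ℕ} (e : a ++ (f ++ s) = b ++ (f ++ t))
    (hab : ∀ x ∈ a ++ b, x = c ∨ x = c + 1) (hcount : a.count (c + 1) = b.count (c + 1))
    (hred : ¬ [c, c] <:+: a ++ (f ++ s)) (hf : f = [c] ∨ f = [c + 1] ∨ f = [])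
    (hb : f = [] → ¬ [c] <:+ b) (ht : f = [] → ¬ [c] <+: t) : a = b := by
  -- The surplus `d` of the longer prefix consists of letters `c` only. In front of `f = [c]` a
  -- nonempty surplus produces `c c`; for `f = [c + 1]` the first letters disagree.
  have hd : ∀ d : List ℕ, (∀ x ∈ d, x = c ∨ x = c + 1) → d.count (c + 1) = 0 →
      ∀ s t : List ℕ, f ++ s = d ++ (f ++ t) → ¬ [c, c] <:+: f ++ s → f ≠ [] → d = [] := by
    intro d hd hc s t e hred hf'
    rw [List.count_eq_zero] at hc
    have hd' : ∀ x ∈ d, x = c := fun x hx => (hd x hx).resolve_right fun h => hc (h ▸ hx)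
    rcases d with _ | ⟨x, d⟩
    · rfl
    exfalso
    obtain rfl : x = c := hd' x (by simp)
    rcases hf with rfl | rfl | rfl
    · apply hred
      rw [e]
      rcases d with _ | ⟨y, d⟩
      · exact ⟨[], t, by simp⟩
      · obtain rfl : y = x := hd' y (by simp)
        exact ⟨[], d ++ ([y] ++ t), by simp⟩
    · simp at e
    · exact hf' rfl
  -- For empty `f`, a nonempty surplus would put `c` at the end of `b` or at the start of `t`,
  -- against the two conditions at the cut.
  have hne : ∀ d : List ℕ, (∀ x ∈ d, x = c ∨ x = c + 1) → d.count (c + 1) = 0 → d ≠ [] →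
      [c] <:+ d ∧ [c] <+: d := by
    intro d hd hc hd0
    rw [List.count_eq_zero] at hc
    have hd' : ∀ x ∈ d, x = c := fun x hx => (hd x hx).resolve_right fun h => hc (h ▸ hx)
    constructor
    · have h₁ := hd' _ (List.getLast_mem hd0)
      exact ⟨d.dropLast, by rw [← h₁]; exact List.dropLast_append_getLast hd0⟩
    · have h₁ := hd' _ (List.head_mem hd0)
      exact ⟨d.tail, by rw [← h₁]; exact List.cons_head_tail hd0⟩
  rcases List.append_eq_append_iff.1 e with ⟨d, rfl, e'⟩ | ⟨d, rfl, e'⟩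
  · have hdm : ∀ x ∈ d, x = c ∨ x = c + 1 := fun x hx => hab x (by simp [hx])
    have hdc : d.count (c + 1) = 0 := by
      rw [List.count_append] at hcount; omega
    suffices d = [] by simp [this]
    by_cases hf' : f = []
    · by_contra hd0
      exact hb hf' ((hne d hdm hdc hd0).1.trans (List.suffix_append _ _))
    · exact hd d hdm hdc s t e' (fun h => hred (h.trans (List.suffix_append _ _).isInfix)) hf'
  · have hdm : ∀ x ∈ d, x = c ∨ x = c + 1 := fun x hx => hab x (by simp [hx])
    have hdc : d.count (c + 1) = 0 := by
      rw [List.count_append] at hcount; omega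
    suffices d = [] by simp [this]
    by_cases hf' : f = []
    · by_contra hd0
      refine ht hf' ((hne d hdm hdc hd0).2.trans ?_)
      subst hf'
      simp only [List.nil_append] at e'
      rw [e']
      exact List.prefix_append _ _
    · rw [e] at hred
      exact hd d hdm hdc t s e' (fun h => hred (h.trans (List.suffix_append _ _).isInfix)) hf'

/-- Descending induction on `c`: the projection for `c + 1` fixes the number of letters `c + 1`, and
`eq_of_append_eq_append` then fixes the projection for `c`. The conditions at the cut are needed for
one of the two factorizations only. -/
theorem TriangularWord.unique {N : ℕ} {w : List ℕ} {S : FibonacciSet N} {ρ τ ρ' τ' : List ℕ}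
    (h : TriangularWord N w S ρ τ) (hred : ReducedWord w) (hw : ∀ i ∈ w, i < N)
    (h' : TraceEq w (ρ' ++ S.freeWord ++ τ')) : TraceEq ρ' ρ ∧ TraceEq τ' τ := by
  have e : ∀ c, adjFilter c ρ' ++ (adjFilter c S.freeWord ++ adjFilter c τ') =
      adjFilter c ρ ++ (adjFilter c S.freeWord ++ adjFilter c τ) := by
    intro c
    have := h'.symm.trans h.traceEq c
    simpa using this
  have hρ : ∀ i ∈ ρ, i < N := fun i hi => hw i ((h.traceEq.mem_iff i).2 (by simp [hi]))
  have hρ' : ∀ i ∈ ρ', i < N := fun i hi => hw i ((h'.mem_iff i).2 (by simp [hi]))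
  have key : TraceEq ρ' ρ := by
    intro c
    by_cases hc : N ≤ c
    · rw [adjFilter_eq_nil_of_lt fun i hi => (hρ i hi).trans_le hc,
        adjFilter_eq_nil_of_lt fun i hi => (hρ' i hi).trans_le hc]
    · have hc' : c ≤ N := by omega
      clear hc
      induction hc' using Nat.decreasingInduction with
      | self => rw [adjFilter_eq_nil_of_lt hρ, adjFilter_eq_nil_of_lt hρ']
      | of_succ c hcN ih =>
        have hfw := S.adjFilter_freeWord c
        refine eq_of_append_eq_append (c := c) (e c) ?_ ?_ ?_ ?_ ?_ ?_
        · intro x hx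
          rw [List.mem_append, mem_adjFilter, mem_adjFilter] at hx
          exact hx.elim And.right And.right
        · rw [count_adjFilter _ (Or.inr rfl), count_adjFilter _ (Or.inr rfl),
            ← count_adjFilter (c := c + 1) _ (Or.inl rfl), ih,
            count_adjFilter _ (Or.inl rfl)]
        · rw [← adjFilter_append, ← adjFilter_append, ← List.append_assoc, ← h' c]
          exact hred c
        · rw [hfw]
          split_ifs <;> simp
        · intro h0
          rw [hfw] at h0
          split_ifs at h0 with h₁ h₂
          exact h.left c h₁ h₂
        · intro h0
          rw [hfw] at h0
          split_ifs at h0 with h₁ h₂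
          exact h.right c h₁ h₂
  refine ⟨key, fun c => ?_⟩
  have := e c
  rw [key c] at this
  simpa using this

/-! ## Labelled perfect matchings -/

/-- A perfect matching of `V` whose pairs carry labels. -/
@[ext]
structure LabelledMatching (V : Type*) where
  partner : V → V
  label : V → ℕ
  partner_partner : ∀ v, partner (partner v) = v
  partner_ne : ∀ v, partner v ≠ v
  label_partner : ∀ v, label (partner v) = label v

namespace LabelledMatching

variable {V : Type*} [DecidableEq V]

/-- Joins `p` and `q` by a strand of label `l`, and attaches a new pair of label `l` to `p` and
`q`. -/
def join (M : LabelledMatching V) (p q : V) (hpq : p ≠ q) (l : ℕ) : LabelledMatching V where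
  partner v := if v = p then q else if v = q then p else
    if M.partner v = p then M.partner q else if M.partner v = q then M.partner p else M.partner v
  label v := if v = p ∨ v = q then l else
    if M.partner v = p ∨ M.partner v = q then min (min (M.label p) (M.label q)) l else M.label v
  partner_partner v := by
    have h := M.partner_partner
    have h' := M.partner_ne
    grind
  partner_ne v := by
    have h := M.partner_partner
    have h' := M.partner_ne
    grind
  label_partner v := by
    have h := M.partner_partner
    have h' := M.partner_ne
    have h'' := M.label_partner
    grind

/-- Covers both the commutation of distant generators on one side and the commutation of joins on
the left with joins on the right. -/
theorem join_comm (M : LabelledMatching V) {p q r s : V} (hpq : p ≠ q) (hrs : r ≠ s) (hpr : p ≠ r)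
    (hps : p ≠ s) (hqr : q ≠ r) (hqs : q ≠ s) (l l' : ℕ) :
    (M.join p q hpq l).join r s hrs l' = (M.join r s hrs l').join p q hpq l := by
  have h := M.partner_partner
  have h' := M.partner_ne
  have h'' := M.label_partner
  ext v
  · have hi : ∀ a b, M.partner a = M.partner b → a = b := fun a b e => by
      rw [← h a, e, h]
    simp only [join]
    grind (splits := 30)
  · simp only [join]
    grind (splits := 30)

end LabelledMatching

/-! ## Arc-diagrams of words -/

/-- Joins the nodes `i` and `i + 1` of one side, given by `φ`, for `1 ≤ i < N`. -/
def sideJoin {N : ℕ} (φ : Fin N ↪ Fin N ⊕ Fin N) (i : ℕ) (M : LabelledMatching (Fin N ⊕ Fin N)) :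
    LabelledMatching (Fin N ⊕ Fin N) :=
  if h : 1 ≤ i ∧ i < N then
    M.join (φ ⟨i - 1, by omega⟩) (φ ⟨i, h.2⟩)
      (fun e => by have := congrArg Fin.val (φ.injective e); simp only at this; omega) i
  else M

/-- The matching of the identity diagram. -/
def idMatching (N : ℕ) : LabelledMatching (Fin N ⊕ Fin N) where
  partner := Sum.swap
  label := Sum.elim (fun j => j + 1) (fun j => j + 1)
  partner_partner v := by simp
  partner_ne v := by cases v <;> simp
  label_partner v := by cases v <;> simp

/-- The labelled arcs of a matching. -/
def LabelledMatching.toArcs {N : ℕ} (M : LabelledMatching (Fin N ⊕ Fin N)) : LabelledArcs N :=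
  {p | ∃ v, p = (s(v, M.partner v), M.label v)}

theorem toArcs_idMatching (N : ℕ) : (idMatching N).toArcs = LabelledArcs.identity N := by
  ext p
  constructor
  · rintro ⟨v | v, rfl⟩
    · exact ⟨v, rfl⟩
    · exact ⟨v, by rw [Sym2.eq_swap]; rfl⟩
  · rintro ⟨j, rfl⟩
    exact ⟨Sum.inl j, rfl⟩

namespace LabelledMatching

variable {N : ℕ} (M : LabelledMatching (Fin N ⊕ Fin N))

theorem mem_toArcs {a b : Fin N ⊕ Fin N} {h : ℕ} :
    (s(a, b), h) ∈ M.toArcs ↔ b = M.partner a ∧ h = M.label a := by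
  constructor
  · rintro ⟨v, hv⟩
    rw [Prod.mk.injEq, Sym2.eq_iff] at hv
    rcases hv with ⟨⟨rfl, rfl⟩ | ⟨rfl, rfl⟩, rfl⟩
    · exact ⟨rfl, rfl⟩
    · exact ⟨(M.partner_partner _).symm, (M.label_partner _).symm⟩
  · rintro ⟨rfl, rfl⟩
    exact ⟨a, rfl⟩

theorem propLab_toArcs : M.toArcs.propLab =
    {h | ∃ a b, M.partner (Sum.inl a) = Sum.inr b ∧ M.label (Sum.inl a) = h} := by
  ext h
  simp only [LabelledArcs.propLab, Set.mem_ofPred_eq, mem_toArcs]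
  exact exists_congr fun a => exists_congr fun b => and_congr eq_comm eq_comm

end LabelledMatching

namespace LabelledArcs

open LabelledMatching

variable {N : ℕ}

theorem mem_elementary {i : ℕ} {p q : Fin N} (hp : (p : ℕ) + 1 = i) (hq : (q : ℕ) = i)
    {a b : Fin N ⊕ Fin N} {h : ℕ} : (s(a, b), h) ∈ elementary N i ↔
      (∃ j, j ≠ p ∧ j ≠ q ∧ h = j + 1 ∧
        ((a = Sum.inl j ∧ b = Sum.inr j) ∨ (a = Sum.inr j ∧ b = Sum.inl j))) ∨
      (h = i ∧ ((a = Sum.inl p ∧ b = Sum.inl q) ∨ (a = Sum.inl q ∧ b = Sum.inl p) ∨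
        (a = Sum.inr p ∧ b = Sum.inr q) ∨ (a = Sum.inr q ∧ b = Sum.inr p))) := by
  have hne : ∀ j : Fin N, ((j : ℕ) + 1 ≠ i ↔ j ≠ p) ∧ ((j : ℕ) + 1 ≠ i + 1 ↔ j ≠ q) := by
    intro j
    constructor <;> rw [not_iff_not, Fin.ext_iff] <;> omega
  constructor
  · rintro (⟨j, h₁, h₂, e⟩ | ⟨a', b', ha, hb, e | e⟩)
    · rw [Prod.mk.injEq, Sym2.eq_iff] at e
      exact Or.inl ⟨j, (hne j).1.1 h₁, (hne j).2.1 h₂, e.2, e.1⟩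
    all_goals
      obtain rfl : a' = p := Fin.ext (by omega)
      obtain rfl : b' = q := Fin.ext (by omega)
      rw [Prod.mk.injEq, Sym2.eq_iff] at e
      exact Or.inr ⟨e.2, by tauto⟩
  · rintro (⟨j, h₁, h₂, rfl, e⟩ | ⟨rfl, e⟩)
    · refine Or.inl ⟨j, (hne j).1.2 h₁, (hne j).2.2 h₂, ?_⟩
      rw [Prod.mk.injEq, Sym2.eq_iff]
      exact ⟨e, rfl⟩
    · refine Or.inr ⟨p, q, hp, by omega, ?_⟩
      simp only [Prod.mk.injEq, Sym2.eq_iff]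
      tauto

/-- The fragments of the composition of an elementary diagram with a matching. -/
theorem fragment_iff {M : LabelledMatching (Fin N ⊕ Fin N)} {i : ℕ} {p q : Fin N}
    (hp : (p : ℕ) + 1 = i) (hq : (q : ℕ) = i) {u v : GluedNode N} {h : ℕ} :
    Fragment (elementary N i) M.toArcs u v h ↔
      (∃ j, j ≠ p ∧ j ≠ q ∧ h = j + 1 ∧
        ((u = .left j ∧ v = .mid j) ∨ (u = .mid j ∧ v = .left j))) ∨
      (h = i ∧ ((u = .left p ∧ v = .left q) ∨ (u = .left q ∧ v = .left p) ∨
        (u = .mid p ∧ v = .mid q) ∨ (u = .mid q ∧ v = .mid p))) ∨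
      (∃ a, u = sndNode a ∧ v = sndNode (M.partner a) ∧ h = M.label a) := by
  rw [Fragment, ← or_assoc]
  refine or_congr ?_ ?_
  · simp only [mem_elementary hp hq]
    constructor
    · rintro ⟨a, b, ⟨j, h₁, h₂, rfl, ⟨rfl, rfl⟩ | ⟨rfl, rfl⟩⟩ | ⟨rfl, ⟨rfl, rfl⟩ | ⟨rfl, rfl⟩ |
        ⟨rfl, rfl⟩ | ⟨rfl, rfl⟩⟩, rfl, rfl⟩
      · exact Or.inl ⟨j, h₁, h₂, rfl, Or.inl ⟨rfl, rfl⟩⟩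
      · exact Or.inl ⟨j, h₁, h₂, rfl, Or.inr ⟨rfl, rfl⟩⟩
      · exact Or.inr ⟨rfl, Or.inl ⟨rfl, rfl⟩⟩
      · exact Or.inr ⟨rfl, Or.inr (Or.inl ⟨rfl, rfl⟩)⟩
      · exact Or.inr ⟨rfl, Or.inr (Or.inr (Or.inl ⟨rfl, rfl⟩))⟩
      · exact Or.inr ⟨rfl, Or.inr (Or.inr (Or.inr ⟨rfl, rfl⟩))⟩
    · rintro (⟨j, h₁, h₂, rfl, ⟨rfl, rfl⟩ | ⟨rfl, rfl⟩⟩ | ⟨rfl, ⟨rfl, rfl⟩ | ⟨rfl, rfl⟩ |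
        ⟨rfl, rfl⟩ | ⟨rfl, rfl⟩⟩)
      · exact ⟨Sum.inl j, Sum.inr j, Or.inl ⟨j, h₁, h₂, rfl, Or.inl ⟨rfl, rfl⟩⟩, rfl, rfl⟩
      · exact ⟨Sum.inr j, Sum.inl j, Or.inl ⟨j, h₁, h₂, rfl, Or.inr ⟨rfl, rfl⟩⟩, rfl, rfl⟩
      · exact ⟨Sum.inl p, Sum.inl q, Or.inr ⟨rfl, by tauto⟩, rfl, rfl⟩
      · exact ⟨Sum.inl q, Sum.inl p, Or.inr ⟨rfl, by tauto⟩, rfl, rfl⟩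
      · exact ⟨Sum.inr p, Sum.inr q, Or.inr ⟨rfl, by tauto⟩, rfl, rfl⟩
      · exact ⟨Sum.inr q, Sum.inr p, Or.inr ⟨rfl, by tauto⟩, rfl, rfl⟩
  · simp only [mem_toArcs]
    constructor
    · rintro ⟨a, b, ⟨rfl, rfl⟩, rfl, rfl⟩
      exact ⟨a, rfl, rfl, rfl⟩
    · rintro ⟨a, rfl, rfl, rfl⟩
      exact ⟨a, _, ⟨rfl, rfl⟩, rfl, rfl⟩

/-- Extends a function on the boundary nodes to all nodes of a composition with an elementary
diagram; the nodes in the middle that are joined get the value `d`. -/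
def glueExtend {α : Type*} (f : Fin N ⊕ Fin N → α) (p q : Fin N) (d : α) : GluedNode N → α
  | .left j => f (Sum.inl j)
  | .right j => f (Sum.inr j)
  | .mid j => if j = p ∨ j = q then d else f (Sum.inl j)

theorem glueExtend_outerNode {α : Type*} (f : Fin N ⊕ Fin N → α) (p q : Fin N) (d : α)
    (a : Fin N ⊕ Fin N) : glueExtend f p q d (outerNode a) = f a := by
  cases a <;> rfl

theorem glueExtend_sndNode {α : Type*} (f : Fin N ⊕ Fin N → α) (p q : Fin N) (d : α)
    (a : Fin N ⊕ Fin N) : glueExtend f p q d (sndNode a) =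
      if a = Sum.inl p ∨ a = Sum.inl q then d else f a := by
  cases a <;> simp [glueExtend, sndNode]

/-- A function constant on the pairs of the joined matching extends to an invariant of the strands
of the composition. Such invariants bound from above what is linked to a given node. -/
theorem glueExtend_eq_of_linked {M : LabelledMatching (Fin N ⊕ Fin N)} {i : ℕ} {p q : Fin N}
    (hp : (p : ℕ) + 1 = i) (hq : (q : ℕ) = i) (hpq : (Sum.inl p : Fin N ⊕ Fin N) ≠ Sum.inl q)
    {α : Type*} {f : Fin N ⊕ Fin N → α} {d : α}
    (hf : ∀ a, f ((M.join _ _ hpq i).partner a) = f a)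
    (hd : M.partner (Sum.inl p) ≠ Sum.inl q → d = f (M.partner (Sum.inl p)))
    {u v : GluedNode N} (h : Linked (elementary N i) M.toArcs u v) :
    glueExtend f p q d u = glueExtend f p q d v := by
  induction h with
  | refl => rfl
  | tail _ hvw ih =>
    rw [ih]
    obtain ⟨h, hvw⟩ := hvw
    rw [fragment_iff hp hq] at hvw
    have hPQ : f (Sum.inl p) = f (Sum.inl q) := by
      have := hf (Sum.inl p)
      simpa [join] using this.symm
    rcases hvw with ⟨j, h₁, h₂, -, ⟨rfl, rfl⟩ | ⟨rfl, rfl⟩⟩ | ⟨-, ⟨rfl, rfl⟩ | ⟨rfl, rfl⟩ |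
        ⟨rfl, rfl⟩ | ⟨rfl, rfl⟩⟩ | ⟨a, rfl, rfl, -⟩
    · simp [glueExtend, h₁, h₂]
    · simp [glueExtend, h₁, h₂]
    · simp [glueExtend, hPQ]
    · simp [glueExtend, hPQ]
    · simp [glueExtend]
    · simp [glueExtend]
    · rw [glueExtend_sndNode, glueExtend_sndNode]
      have k₁ := hf a
      have k₂ := hf (M.partner (Sum.inl p))
      have i₁ := M.partner_partner
      have i₂ := M.partner_ne
      simp only [join] at k₁ k₂
      grind

theorem linked_outerNode_sndNode {M : LabelledMatching (Fin N ⊕ Fin N)} {i : ℕ} {p q : Fin N}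
    (hp : (p : ℕ) + 1 = i) (hq : (q : ℕ) = i) {a : Fin N ⊕ Fin N} (hap : a ≠ Sum.inl p)
    (haq : a ≠ Sum.inl q) :
    Linked (elementary N i) M.toArcs (outerNode a) (sndNode a) ∧
      Linked (elementary N i) M.toArcs (sndNode a) (outerNode a) := by
  rcases a with j | j
  · have h₁ : j ≠ p := fun e => hap (e ▸ rfl)
    have h₂ : j ≠ q := fun e => haq (e ▸ rfl)
    exact ⟨.single ⟨j + 1, (fragment_iff hp hq).2 (Or.inl ⟨j, h₁, h₂, rfl, Or.inl ⟨rfl, rfl⟩⟩)⟩,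
      .single ⟨j + 1, (fragment_iff hp hq).2 (Or.inl ⟨j, h₁, h₂, rfl, Or.inr ⟨rfl, rfl⟩⟩)⟩⟩
  · exact ⟨.refl, .refl⟩

theorem fragment_sndNode {M : LabelledMatching (Fin N ⊕ Fin N)} {i : ℕ} {p q : Fin N}
    (hp : (p : ℕ) + 1 = i) (hq : (q : ℕ) = i) (a : Fin N ⊕ Fin N) :
    Fragment (elementary N i) M.toArcs (sndNode a) (sndNode (M.partner a)) (M.label a) :=
  (fragment_iff hp hq).2 (Or.inr (Or.inr ⟨a, rfl, rfl, rfl⟩))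

/-- The boundary nodes joined by the new strand are linked, and the label of the strand is the
label of one of its fragments. -/
theorem linked_join {M : LabelledMatching (Fin N ⊕ Fin N)} {i : ℕ} {p q : Fin N}
    (hp : (p : ℕ) + 1 = i) (hq : (q : ℕ) = i) (hpq : (Sum.inl p : Fin N ⊕ Fin N) ≠ Sum.inl q)
    (a : Fin N ⊕ Fin N) :
    Linked (elementary N i) M.toArcs (outerNode a)
        (outerNode ((M.join _ _ hpq i).partner a)) ∧
      ∃ u v, Linked (elementary N i) M.toArcs (outerNode a) u ∧
        Fragment (elementary N i) M.toArcs u v ((M.join _ _ hpq i).label a) := by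
  have hout : ∀ x y : Fin N, (x = p ∧ y = q) ∨ (x = q ∧ y = p) →
      Fragment (elementary N i) M.toArcs (.left x) (.left y) i := by
    rintro x y (⟨rfl, rfl⟩ | ⟨rfl, rfl⟩)
    · exact (fragment_iff hp hq).2 (Or.inr (Or.inl ⟨rfl, Or.inl ⟨rfl, rfl⟩⟩))
    · exact (fragment_iff hp hq).2 (Or.inr (Or.inl ⟨rfl, Or.inr (Or.inl ⟨rfl, rfl⟩)⟩))
  have hmid : ∀ x y : Fin N, (x = p ∧ y = q) ∨ (x = q ∧ y = p) →
      Fragment (elementary N i) M.toArcs (sndNode (Sum.inl x)) (sndNode (Sum.inl y)) i := by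
    rintro x y (⟨rfl, rfl⟩ | ⟨rfl, rfl⟩)
    · exact (fragment_iff hp hq).2 (Or.inr (Or.inl ⟨rfl, Or.inr (Or.inr (Or.inl ⟨rfl, rfl⟩))⟩))
    · exact (fragment_iff hp hq).2 (Or.inr (Or.inl ⟨rfl, Or.inr (Or.inr (Or.inr ⟨rfl, rfl⟩))⟩))
  have hfr := fun a => fragment_sndNode (M := M) hp hq a
  have hpp := M.partner_partner
  have hpn := M.partner_ne
  have hlp := M.label_partner
  -- the strand of a node whose partner is joined
  have main : ∀ x y : Fin N, (x = p ∧ y = q) ∨ (x = q ∧ y = p) → a ≠ Sum.inl p → a ≠ Sum.inl q →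
      M.partner a = Sum.inl x →
      Linked (elementary N i) M.toArcs (outerNode a) (outerNode (M.partner (Sum.inl y))) ∧
      ∃ u v, Linked (elementary N i) M.toArcs (outerNode a) u ∧
        Fragment (elementary N i) M.toArcs u v
          (min (min (M.label (Sum.inl x)) (M.label (Sum.inl y))) i) := by
    intro x y hxy hap haq hax
    have l₁ := (linked_outerNode_sndNode (M := M) hp hq hap haq).1
    have f₁ := hfr a
    rw [hax] at f₁
    have l₂ := l₁.tail ⟨_, f₁⟩
    have l₃ := l₂.tail ⟨_, hmid x y hxy⟩
    have l₄ := l₃.tail ⟨_, hfr (Sum.inl y)⟩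
    have hy : ∀ z, z = p ∨ z = q → M.partner (Sum.inl y) ≠ Sum.inl z := by
      rintro z hz e
      rcases hxy with ⟨rfl, rfl⟩ | ⟨rfl, rfl⟩ <;> rcases hz with rfl | rfl
      · exact haq (by rw [← hpp a, hax, ← e, hpp])
      · exact hpn _ e
      · exact hpn _ e
      · exact hap (by rw [← hpp a, hax, ← e, hpp])
    have l₅ := (linked_outerNode_sndNode (M := M) hp hq (hy p (Or.inl rfl))
      (hy q (Or.inr rfl))).2
    refine ⟨l₄.trans l₅, ?_⟩
    rcases min_choice (min (M.label (Sum.inl x)) (M.label (Sum.inl y))) i with e | e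
    · rcases min_choice (M.label (Sum.inl x)) (M.label (Sum.inl y)) with e' | e'
      · rw [e, e']
        exact ⟨_, _, l₂, hfr _⟩
      · rw [e, e']
        exact ⟨_, _, l₃, hfr _⟩
    · rw [e]
      exact ⟨_, _, l₂, hmid x y hxy⟩
  by_cases hap : a = Sum.inl p
  · subst hap
    have e : (M.join _ _ hpq i).partner (Sum.inl p) = Sum.inl q := by simp [join]
    have e' : (M.join _ _ hpq i).label (Sum.inl p) = i := by simp [join]
    rw [e, e']
    exact ⟨.single ⟨i, hout p q (by simp)⟩, _, _, .refl, hout p q (by simp)⟩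
  by_cases haq : a = Sum.inl q
  · subst haq
    have e : (M.join _ _ hpq i).partner (Sum.inl q) = Sum.inl p := by simp [join, hpq.symm]
    have e' : (M.join _ _ hpq i).label (Sum.inl q) = i := by simp [join]
    rw [e, e']
    exact ⟨.single ⟨i, hout q p (by simp)⟩, _, _, .refl, hout q p (by simp)⟩
  simp only [join, hap, haq, if_false, or_self]
  by_cases h₁ : M.partner a = Sum.inl p
  · simp only [h₁, if_true, true_or]
    exact main p q (by simp) hap haq h₁
  by_cases h₂ : M.partner a = Sum.inl q
  · simp only [h₂, hpq.symm, if_true, or_true, if_false]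
    rw [min_comm (M.label (Sum.inl p))]
    exact main q p (by simp) hap haq h₂
  simp only [h₁, h₂, if_false, or_self]
  have l := (linked_outerNode_sndNode (M := M) hp hq hap haq).1
  exact ⟨(l.tail ⟨_, hfr a⟩).trans (linked_outerNode_sndNode (M := M) hp hq h₁ h₂).2,
    _, _, l, hfr a⟩

/-- The composition of an elementary diagram with a matching. -/
theorem comp_elementary {M : LabelledMatching (Fin N ⊕ Fin N)} {i : ℕ} {p q : Fin N}
    (hp : (p : ℕ) + 1 = i) (hq : (q : ℕ) = i) (hpq : (Sum.inl p : Fin N ⊕ Fin N) ≠ Sum.inl q)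
    -- Under this bound the straight arcs of the elementary diagram, with labels `j + 1`, never
    -- lower a minimum.
    (hM : ∀ j : Fin N, M.label (Sum.inl j) ≤ j + 1) :
    comp (elementary N i) M.toArcs = (M.join _ _ hpq i).toArcs := by
  set M' := M.join _ _ hpq i with hM'
  have hpp := M.partner_partner
  have hpn := M.partner_ne
  have hlp := M.label_partner
  have hleast : ∀ a, IsLeast {h | ∃ u v, Linked (elementary N i) M.toArcs (outerNode a) u ∧
      Fragment (elementary N i) M.toArcs u v h} (M'.label a) := by
    intro a
    refine ⟨(linked_join hp hq hpq a).2, ?_⟩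
    rintro h ⟨u, v, hu, huv⟩
    have key := glueExtend_eq_of_linked hp hq hpq (f := M'.label)
      -- If `p` and `q` are partners, the merged nodes form a loop and their value is free; `0`
      -- makes the bound `hd` trivial.
      (d := if M.partner (Sum.inl p) = Sum.inl q then 0 else M'.label (M.partner (Sum.inl p)))
      M'.label_partner (fun h => if_neg h) hu
    rw [glueExtend_outerNode] at key
    rw [key]
    have hd : (if M.partner (Sum.inl p) = Sum.inl q then 0
        else M'.label (M.partner (Sum.inl p))) ≤
        min (min (M.label (Sum.inl p)) (M.label (Sum.inl q))) i := by
      simp only [hM', join]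
      grind
    have hd' := hd.trans (min_le_right _ _)
    have hd'' := hd.trans (min_le_left _ _)
    have hle : ∀ a, a ≠ Sum.inl p → a ≠ Sum.inl q → M'.label a ≤ M.label a := by
      intro a h₁ h₂
      simp only [hM', join]
      grind
    rw [fragment_iff hp hq] at huv
    rcases huv with ⟨j, h₁, h₂, rfl, ⟨rfl, rfl⟩ | ⟨rfl, rfl⟩⟩ | ⟨rfl, ⟨rfl, rfl⟩ | ⟨rfl, rfl⟩ |
        ⟨rfl, rfl⟩ | ⟨rfl, rfl⟩⟩ | ⟨a, rfl, rfl, rfl⟩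
    · exact (hle _ (by simpa using h₁) (by simpa using h₂)).trans (hM j)
    · rw [glueExtend, if_neg (by tauto)]
      exact (hle _ (by simpa using h₁) (by simpa using h₂)).trans (hM j)
    · simp [glueExtend, hM', join]
    · simp [glueExtend, hM', join]
    · rw [glueExtend, if_pos (by tauto)]
      exact hd'
    · rw [glueExtend, if_pos (by tauto)]
      exact hd'
    · rw [glueExtend_sndNode]
      by_cases h₁ : a = Sum.inl p ∨ a = Sum.inl q
      · rw [if_pos h₁]
        rcases h₁ with rfl | rfl
        · exact hd''.trans (min_le_left _ _)
        · exact hd''.trans (min_le_right _ _)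
      · rw [if_neg h₁]
        push Not at h₁
        exact hle a h₁.1 h₁.2
  ext ⟨e, h⟩
  constructor
  · rintro ⟨a, b, hab, rfl, hl, hh⟩
    -- The pair containing a node serves as the invariant, so distinct linked boundary nodes are
    -- partners.
    have key := glueExtend_eq_of_linked hp hq hpq (f := fun a => s(a, M'.partner a))
      (d := s(M.partner (Sum.inl p), M'.partner (M.partner (Sum.inl p))))
      (fun a => by rw [← hM', M'.partner_partner, Sym2.eq_swap]) (fun _ => rfl) hl
    rw [glueExtend_outerNode, glueExtend_outerNode, Sym2.eq_iff] at key
    have hb : b = M'.partner a := by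
      rcases key with ⟨rfl, -⟩ | ⟨-, rfl⟩
      · exact (hab rfl).elim
      · rfl
    exact (mem_toArcs M').2 ⟨hb, hh.unique (hleast a)⟩
  · rintro ⟨a, hv⟩
    rw [Prod.mk.injEq] at hv
    obtain ⟨rfl, rfl⟩ := hv
    exact ⟨a, _, (M'.partner_ne a).symm, rfl, (linked_join hp hq hpq a).1, hleast a⟩

end LabelledArcs

/-- The matching of a word. -/
def wordMatching (N : ℕ) (w : List ℕ) : LabelledMatching (Fin N ⊕ Fin N) :=
  w.foldr (sideJoin Function.Embedding.inl) (idMatching N)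

/-- A new pair of label `i` sits on the nodes `i` and `i + 1`, and all other labels can only
decrease. -/
theorem label_foldr_sideJoin_le {N : ℕ} (φ : Fin N ↪ Fin N ⊕ Fin N)
    {M : LabelledMatching (Fin N ⊕ Fin N)} (hM : ∀ j : Fin N, M.label (φ j) ≤ j + 1) (w : List ℕ)
    (j : Fin N) : (w.foldr (sideJoin φ) M).label (φ j) ≤ j + 1 := by
  induction w generalizing j with
  | nil => exact hM j
  | cons i w ih =>
    rw [List.foldr_cons, sideJoin]
    split_ifs with h
    · have hl := (w.foldr (sideJoin φ) M).label_partner (φ j)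
      simp only [LabelledMatching.join, φ.injective.eq_iff]
      split_ifs with h₁ h₂
      · simp only [Fin.ext_iff] at h₁
        omega
      · refine le_trans ?_ (ih j)
        rw [← hl]
        rcases h₂ with h₂ | h₂ <;> rw [h₂]
        · exact (min_le_left _ _).trans (min_le_left _ _)
        · exact (min_le_left _ _).trans (min_le_right _ _)
      · exact ih j
    · exact ih j

theorem label_wordMatching_le {N : ℕ} (w : List ℕ) (j : Fin N) :
    (wordMatching N w).label (Sum.inl j) ≤ j + 1 :=
  label_foldr_sideJoin_le .inl (fun _ => le_rfl) w j

theorem foldr_comp_eq_toArcs {N : ℕ} (w : List ℕ) (hw : ∀ i ∈ w, 1 ≤ i ∧ i < N) :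
    (w.map (LabelledArcs.elementary N)).foldr LabelledArcs.comp (LabelledArcs.identity N) =
      (wordMatching N w).toArcs := by
  induction w with
  | nil => exact (toArcs_idMatching N).symm
  | cons i w ih =>
    have hi := hw i (by simp)
    rw [List.map_cons, List.foldr_cons, ih fun j hj => hw j (by simp [hj]),
      LabelledArcs.comp_elementary (p := ⟨i - 1, by omega⟩) (q := ⟨i, hi.2⟩) (by simp; omega) rfl
        (by simp; omega) (label_wordMatching_le w)]
    rw [wordMatching, wordMatching, List.foldr_cons, sideJoin, dif_pos hi]
    rfl

theorem ofPerm_eq_toArcs {N : ℕ} (σ : Equiv.Perm (Fin N)) :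
    LabelledArcs.ofPerm σ = (wordMatching N (permWord σ)).toArcs :=
  foldr_comp_eq_toArcs _ (permWord_range σ)

/-! ## Propagating labels -/

section

variable {N : ℕ}

theorem sideJoin_comm (φ : Fin N ↪ Fin N ⊕ Fin N) {i j : ℕ} (h : i + 2 ≤ j)
    (M : LabelledMatching (Fin N ⊕ Fin N)) :
    sideJoin φ i (sideJoin φ j M) = sideJoin φ j (sideJoin φ i M) := by
  rw [sideJoin, sideJoin, sideJoin, sideJoin]
  split_ifs with hi hj
  · refine (LabelledMatching.join_comm M _ _ ?_ ?_ ?_ ?_ _ _).symm <;>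
      (intro e; have := congrArg Fin.val (φ.injective e); simp only at this; omega)
  all_goals rfl

theorem sideJoin_inl_inr (i j : ℕ) (M : LabelledMatching (Fin N ⊕ Fin N)) :
    sideJoin .inl i (sideJoin .inr j M) = sideJoin .inr j (sideJoin .inl i M) := by
  rw [sideJoin, sideJoin, sideJoin, sideJoin]
  split_ifs with hi hj
  · refine (LabelledMatching.join_comm M _ _ ?_ ?_ ?_ ?_ _ _).symm <;> simp
  all_goals rfl

/-- An elementary diagram can be attached to the identity from either side. Since joins on opposite
sides commute, a matching can therefore be built from the right end of its word as well. -/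
theorem sideJoin_idMatching (i : ℕ) :
    sideJoin .inl i (idMatching N) = sideJoin .inr i (idMatching N) := by
  rw [sideJoin, sideJoin]
  split_ifs with h
  · ext v
    · rcases v with v | v <;> simp only [LabelledMatching.join, idMatching, Sum.swap_inl,
        Sum.swap_inr, Function.Embedding.inl_apply, Function.Embedding.inr_apply] <;> grind
    · rcases v with v | v <;> simp only [LabelledMatching.join, idMatching, Sum.swap_inl,
        Sum.swap_inr, Function.Embedding.inl_apply, Function.Embedding.inr_apply, Sum.elim_inl,
        Sum.elim_inr] <;> grind
  · rfl

theorem foldr_sideJoin_comm (u v : List ℕ) (M : LabelledMatching (Fin N ⊕ Fin N)) :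
    u.foldr (sideJoin .inl) (v.foldr (sideJoin .inr) M) =
      v.foldr (sideJoin .inr) (u.foldr (sideJoin .inl) M) := by
  have h₁ : ∀ (i : ℕ) M, sideJoin .inl i (v.foldr (sideJoin .inr) M) =
      v.foldr (sideJoin (N := N) .inr) (sideJoin .inl i M) := by
    intro i M
    induction v with
    | nil => rfl
    | cons j v ih => rw [List.foldr_cons, List.foldr_cons, sideJoin_inl_inr, ih]
  induction u with
  | nil => rfl
  | cons i u ih => rw [List.foldr_cons, List.foldr_cons, ih, h₁]

theorem wordMatching_eq_foldr_inr (w : List ℕ) :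
    wordMatching N w = w.reverse.foldr (sideJoin .inr) (idMatching N) := by
  induction w with
  | nil => rfl
  | cons i w ih =>
    have h := foldr_sideJoin_comm [i] w.reverse (idMatching N)
    rw [wordMatching, List.foldr_cons, ← wordMatching, ih, List.reverse_cons, List.foldr_append,
      List.foldr_cons, List.foldr_nil, ← sideJoin_idMatching]
    exact h

theorem wordMatching_append (u v : List ℕ) :
    wordMatching N (u ++ v) = v.reverse.foldr (sideJoin .inr) (wordMatching N u) := by
  rw [wordMatching, List.foldr_append, ← wordMatching, wordMatching_eq_foldr_inr,
    foldr_sideJoin_comm, wordMatching]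

theorem wordMatching_append' (u v : List ℕ) :
    wordMatching N (u ++ v) = u.foldr (sideJoin .inl) (wordMatching N v) := by
  rw [wordMatching, List.foldr_append, wordMatching]

theorem TraceEq.wordMatching_eq {u v : List ℕ} (h : TraceEq u v) :
    wordMatching N u = wordMatching N v := by
  let f : ℕ → Function.End (LabelledMatching (Fin N ⊕ Fin N)) := fun i => sideJoin .inl i
  have key : ∀ w : List ℕ, wordMatching N w = (w.map f).prod (idMatching N) := by
    intro w
    induction w with
    | nil => rfl
    | cons i w ih =>
      rw [wordMatching, List.foldr_cons, ← wordMatching, ih, List.map_cons, List.prod_cons]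
      rfl
  rw [key, key, h.prod_map_eq]
  intro a _ b _ hab
  exact funext fun M => sideJoin_comm _ hab M

/-- The labels of the pairs that join a node outside the side given by `φ` to a node of that
side. -/
def crossLabels (φ : Fin N ↪ Fin N ⊕ Fin N) (M : LabelledMatching (Fin N ⊕ Fin N)) : Multiset ℕ :=
  (Finset.univ.filter (fun v => (¬ ∃ j, φ j = v) ∧ ∃ j, φ j = M.partner v)).val.map M.label

theorem crossLabels_inl_eq_inr (M : LabelledMatching (Fin N ⊕ Fin N)) :
    crossLabels .inl M = crossLabels .inr M := by
  rw [crossLabels, crossLabels]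
  refine Multiset.map_eq_map_of_bij_of_nodup _ _ (Finset.nodup _) (Finset.nodup _)
    (fun v _ => M.partner v) ?_ ?_ ?_ ?_
  · intro v hv
    simp only [Finset.mem_val, Finset.mem_filter, Finset.mem_univ, true_and,
      M.partner_partner] at hv ⊢
    obtain ⟨h, j, hj⟩ := hv
    rcases v with v | v
    · exact (h ⟨v, rfl⟩).elim
    · rw [← hj]
      exact ⟨by simp, v, rfl⟩
  · intro v _ w _ h
    rw [← M.partner_partner v, h, M.partner_partner]
  · intro v hv
    refine ⟨M.partner v, ?_, M.partner_partner v⟩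
    simp only [Finset.mem_val, Finset.mem_filter, Finset.mem_univ, true_and,
      M.partner_partner] at hv ⊢
    obtain ⟨h, j, hj⟩ := hv
    rcases v with v | v
    · rw [← hj]
      exact ⟨by simp, v, rfl⟩
    · exact (h ⟨v, rfl⟩).elim
  · intro v _
    exact (M.label_partner v).symm

theorem propLab_toArcs_eq (M : LabelledMatching (Fin N ⊕ Fin N)) :
    M.toArcs.propLab = {h | h ∈ crossLabels .inr M} := by
  ext h
  rw [LabelledMatching.propLab_toArcs]
  simp only [Set.mem_ofPred_eq, crossLabels, Multiset.mem_map, Finset.mem_val, Finset.mem_filter,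
    Finset.mem_univ, true_and, Function.Embedding.inr_apply]
  constructor
  · rintro ⟨a, b, e, rfl⟩
    exact ⟨Sum.inl a, ⟨by simp, b, e.symm⟩, rfl⟩
  · rintro ⟨v | v, ⟨h, b, e⟩, rfl⟩
    · exact ⟨v, b, e.symm, rfl⟩
    · exact (h ⟨v, rfl⟩).elim

theorem countP_crossLabels (φ : Fin N ↪ Fin N ⊕ Fin N) (M : LabelledMatching (Fin N ⊕ Fin N))
    (x : ℕ) : (crossLabels φ M).countP (x ≤ ·) = (Finset.univ.filter
      (fun v => ((¬ ∃ j, φ j = v) ∧ ∃ j, φ j = M.partner v) ∧ x ≤ M.label v)).card := by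
  rw [crossLabels, Multiset.countP_map]
  exact congrArg Finset.card (Finset.filter_filter
    (fun v => (¬ ∃ j, φ j = v) ∧ ∃ j, φ j = M.partner v) (fun v => x ≤ M.label v) Finset.univ)

/-- Followed from its end outside the modified side, a pair that propagates after the join
propagated before it, with a label at least as large. -/
theorem countP_crossLabels_sideJoin_le (φ : Fin N ↪ Fin N ⊕ Fin N)
    (M : LabelledMatching (Fin N ⊕ Fin N)) (x i : ℕ) :
    (crossLabels φ (sideJoin φ i M)).countP (x ≤ ·) ≤ (crossLabels φ M).countP (x ≤ ·) := by
  rw [sideJoin]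
  split_ifs with h
  · rw [countP_crossLabels, countP_crossLabels]
    refine Finset.card_le_card fun v hv => ?_
    simp only [Finset.mem_filter, Finset.mem_univ, true_and] at hv ⊢
    obtain ⟨⟨h₁, h₂⟩, h₃⟩ := hv
    have hp : ∀ j, v ≠ φ j := fun j e => h₁ ⟨j, e.symm⟩
    have hl := M.label_partner v
    simp only [LabelledMatching.join, hp, if_false, or_self] at h₂ h₃
    by_cases e : M.partner v = φ ⟨i - 1, by omega⟩
    · rw [if_pos (Or.inl e), ← e, hl] at h₃
      exact ⟨⟨h₁, _, e.symm⟩, by omega⟩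
    by_cases e' : M.partner v = φ ⟨i, h.2⟩
    · rw [if_pos (Or.inr e'), ← e', hl] at h₃
      exact ⟨⟨h₁, _, e'.symm⟩, by omega⟩
    simp only [e, e', if_false, or_self] at h₂ h₃
    exact ⟨⟨h₁, h₂⟩, h₃⟩
  · exact le_rfl

theorem countP_crossLabels_foldr_le (φ : Fin N ↪ Fin N ⊕ Fin N)
    (M : LabelledMatching (Fin N ⊕ Fin N)) (x : ℕ) (w : List ℕ) :
    (crossLabels φ (w.foldr (sideJoin φ) M)).countP (x ≤ ·) ≤
      (crossLabels φ M).countP (x ≤ ·) := by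
  induction w with
  | nil => exact le_rfl
  | cons i w ih => exact (countP_crossLabels_sideJoin_le φ _ x i).trans ih

/-- The relation between two matchings of which the second arises from the first by changes on the
side given by `φ` that affect no propagating label. -/
structure SameCross (φ : Fin N ↪ Fin N ⊕ Fin N) (M M' : LabelledMatching (Fin N ⊕ Fin N)) :
    Prop where
  mem_iff : ∀ v, (¬ ∃ j, φ j = v) → ((∃ j, φ j = M'.partner v) ↔ ∃ j, φ j = M.partner v)
  label_eq : ∀ v, (¬ ∃ j, φ j = v) → M'.label v = M.label v
  partner_eq : ∀ v, (¬ ∃ j, φ j = v) → (¬ ∃ j, φ j = M.partner v) → M'.partner v = M.partner v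

theorem SameCross.crossLabels_eq {φ : Fin N ↪ Fin N ⊕ Fin N}
    {M M' : LabelledMatching (Fin N ⊕ Fin N)} (h : SameCross φ M M') :
    crossLabels φ M' = crossLabels φ M := by
  rw [crossLabels, crossLabels]
  have e : Finset.univ.filter (fun v => (¬ ∃ j, φ j = v) ∧ ∃ j, φ j = M'.partner v) =
      Finset.univ.filter (fun v => (¬ ∃ j, φ j = v) ∧ ∃ j, φ j = M.partner v) :=
    Finset.filter_congr fun v _ => and_congr_right fun hv => h.mem_iff v hv
  rw [e]
  refine Multiset.map_congr rfl fun v hv => h.label_eq v ?_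
  rw [Finset.mem_val, Finset.mem_filter] at hv
  exact hv.2.1

/-- The nodes of a side whose height is the first of the two letters below and above them in the
word `w`. -/
structure SideInvariant (φ : Fin N ↪ Fin N ⊕ Fin N) (w : List ℕ)
    (M : LabelledMatching (Fin N ⊕ Fin N)) : Prop where
  label_le : ∀ j : Fin N, M.label (φ j) ≤ j + 1
  first : ∀ j : Fin N, [(j : ℕ) + 1] <+: adjFilter j w →
    (∃ k, φ k = M.partner (φ j)) ∧ M.label (φ j) = j + 1

/-- By the invariant, node `i + 1` lies on an arc of label `i + 1` within the side, while node `i`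
has label at most `i`. The strand ending at node `i` is prolonged along that arc, and the minimum of
its label with `i + 1` and `i` is its old label. -/
theorem SideInvariant.step {φ : Fin N ↪ Fin N ⊕ Fin N} {w : List ℕ}
    {M : LabelledMatching (Fin N ⊕ Fin N)} (hM : SideInvariant φ w M) {i : ℕ} (hi : 1 ≤ i)
    (hiN : i < N) (hfirst : [i + 1] <+: adjFilter i w) :
    SideInvariant φ (i :: w) (sideJoin φ i M) ∧ SameCross φ M (sideJoin φ i M) := by
  obtain ⟨p, hp⟩ : ∃ p : Fin N, (p : ℕ) + 1 = i := ⟨⟨i - 1, by omega⟩, by simp only; omega⟩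
  obtain ⟨q, hq⟩ : ∃ q : Fin N, (q : ℕ) = i := ⟨⟨i, hiN⟩, rfl⟩
  have hpq : φ p ≠ φ q := fun e => by
    have := congrArg Fin.val (φ.injective e); omega
  have hS : sideJoin φ i M = M.join (φ p) (φ q) hpq i := by
    rw [sideJoin, dif_pos ⟨hi, hiN⟩]
    congr 2 <;> ext <;> simp only <;> omega
  rw [hS]
  obtain ⟨⟨k, hk⟩, hlq⟩ := hM.first q (by rw [hq]; exact hfirst)
  have hlp := hM.label_le p
  rw [hp] at hlp
  rw [hq] at hlq
  have hlab : min (min (M.label (φ p)) (M.label (φ q))) i = M.label (φ p) := by omega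
  refine ⟨⟨fun j => ?_, fun j hj => ?_⟩, ⟨fun v hv => ?_, fun v hv => ?_, fun v hv hv' => ?_⟩⟩
  · simp only [LabelledMatching.join, φ.injective.eq_iff, hlab]
    split_ifs with h₁ h₂
    · rcases h₁ with rfl | rfl <;> omega
    · have h₀ := hM.label_le j
      have h₃ := M.label_partner (φ j)
      rcases h₂ with h₂ | h₂ <;> rw [h₂] at h₃ <;> omega
    · exact hM.label_le j
  · by_cases hjq : j = q
    · subst hjq
      rw [hq, adjFilter_cons, if_pos (Or.inl rfl), List.cons_prefix_cons] at hj
      omega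
    by_cases hjp : j = p
    · subst hjp
      have e₁ : (M.join (φ j) (φ q) hpq i).partner (φ j) = φ q := by simp [LabelledMatching.join]
      have e₂ : (M.join (φ j) (φ q) hpq i).label (φ j) = i := by simp [LabelledMatching.join]
      rw [e₁, e₂]
      exact ⟨⟨q, rfl⟩, hp.symm⟩
    have hj' : ¬ (i = (j : ℕ) ∨ i = (j : ℕ) + 1) := by
      rw [Fin.ext_iff] at hjq hjp
      omega
    rw [adjFilter_cons, if_neg hj'] at hj
    obtain ⟨hk', hl⟩ := hM.first j hj
    have hlj := M.label_partner (φ j)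
    simp only [LabelledMatching.join, φ.injective.eq_iff, hlab, hjp, hjq, if_false, or_self]
    by_cases h₁ : M.partner (φ j) = φ p
    · rw [h₁] at hlj
      rw [if_pos h₁, if_pos (Or.inl h₁)]
      exact ⟨⟨k, hk⟩, by omega⟩
    by_cases h₂ : M.partner (φ j) = φ q
    · rw [h₂] at hlj
      omega
    simp only [h₁, h₂, if_false, or_self]
    exact ⟨hk', hl⟩
  all_goals
    have hv₀ : ∀ j, v ≠ φ j := fun j e => hv ⟨j, e.symm⟩
    have hlv := M.label_partner v
    have hvq : M.partner v ≠ φ q := fun e => hv ⟨k, by rw [hk, ← e, M.partner_partner]⟩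
    simp only [LabelledMatching.join, hlab, hv₀, hvq, if_false, or_false]
  · by_cases h₁ : M.partner v = φ p
    · rw [if_pos h₁]
      exact ⟨fun _ => ⟨p, h₁.symm⟩, fun _ => ⟨k, hk⟩⟩
    · rw [if_neg h₁]
  · by_cases h₁ : M.partner v = φ p
    · rw [if_pos h₁, ← h₁, hlv]
    · rw [if_neg h₁]
  · rw [if_neg fun e => hv' ⟨p, e.symm⟩]

theorem SameCross.refl (φ : Fin N ↪ Fin N ⊕ Fin N) (M : LabelledMatching (Fin N ⊕ Fin N)) :
    SameCross φ M M := ⟨fun _ _ => Iff.rfl, fun _ _ => rfl, fun _ _ _ => rfl⟩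

theorem SameCross.trans {φ : Fin N ↪ Fin N ⊕ Fin N} {M M' M'' : LabelledMatching (Fin N ⊕ Fin N)}
    (h : SameCross φ M M') (h' : SameCross φ M' M'') : SameCross φ M M'' where
  mem_iff v hv := (h'.mem_iff v hv).trans (h.mem_iff v hv)
  label_eq v hv := (h'.label_eq v hv).trans (h.label_eq v hv)
  partner_eq v hv hv' := by
    have e := h.partner_eq v hv hv'
    rw [h'.partner_eq v hv (by rwa [e]), e]

/-- Each letter `i` of `ρ` is followed by `i + 1` before any further `i`: reducedness excludes `i`
coming first, and the condition at the cut excludes that neither letter follows. This is what the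
one-letter step requires. -/
theorem SideInvariant.foldr {φ : Fin N ↪ Fin N ⊕ Fin N} {S : FibonacciSet N}
    {M : LabelledMatching (Fin N ⊕ Fin N)} (hM : SideInvariant φ S.freeWord M) {ρ : List ℕ}
    (hρ : ∀ i ∈ ρ, 1 ≤ i ∧ i < N) (hred : ReducedWord (ρ ++ S.freeWord))
    (hcut : ∀ c, c ∉ S.freeSet → c + 1 ∉ S.freeSet → ¬ [c] <:+ adjFilter c ρ) :
    SameCross φ M (ρ.foldr (sideJoin φ) M) := by
  suffices H : ∀ ρ' : List ℕ, ρ' <:+ ρ → SideInvariant φ (ρ' ++ S.freeWord)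
      (ρ'.foldr (sideJoin φ) M) ∧ SameCross φ M (ρ'.foldr (sideJoin φ) M) from
    (H ρ List.suffix_rfl).2
  intro ρ' hs
  induction ρ' with
  | nil => exact ⟨hM, SameCross.refl φ M⟩
  | cons i ρ' ih =>
    obtain ⟨h₁, h₂⟩ := ih ((List.suffix_cons i ρ').trans hs)
    obtain ⟨hi, hiN⟩ := hρ i (hs.mem (by simp))
    have hfirst : [i + 1] <+: adjFilter i (ρ' ++ S.freeWord) := by
      have hred' : ReducedWord (i :: ρ' ++ S.freeWord) := by
        obtain ⟨t, rfl⟩ := hs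
        rw [List.append_assoc] at hred
        exact hred.of_append_right
      have hred'' := hred' i
      rw [List.cons_append, adjFilter_cons, if_pos (Or.inl rfl)] at hred''
      rcases hl : adjFilter i (ρ' ++ S.freeWord) with _ | ⟨a, l⟩
      · exfalso
        rw [adjFilter_append, List.append_eq_nil_iff] at hl
        have hF : ∀ a ∈ S.freeSet, ¬ (a = i ∨ a = i + 1) := fun a ha ha' => by
          have := mem_adjFilter.2 ⟨FibonacciSet.mem_freeWord.2 ha, ha'⟩
          rw [hl.2] at this
          simp at this
        refine hcut i (fun h => hF i h (Or.inl rfl)) (fun h => hF _ h (Or.inr rfl)) ?_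
        have hsuf : adjFilter i (i :: ρ') <:+ adjFilter i ρ := hs.filter _
        rwa [adjFilter_cons, if_pos (Or.inl rfl), hl.1] at hsuf
      · have ha : a ∈ adjFilter i (ρ' ++ S.freeWord) := by rw [hl]; simp
        rcases (mem_adjFilter.1 ha).2 with rfl | rfl
        · rw [hl] at hred''
          exact (hred'' ⟨[], l, rfl⟩).elim
        · exact ⟨l, rfl⟩
    obtain ⟨h₃, h₄⟩ := h₁.step hi hiN hfirst
    exact ⟨h₃, h₂.trans h₄⟩

end

/-! ## The propagating labels of a factorized word -/

section

variable {N : ℕ}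

/-- The matching of a word of letters that pairwise differ by at least `2`. -/
theorem wordMatching_of_far {w : List ℕ} (hw : ∀ i ∈ w, 1 ≤ i ∧ i < N) (hn : w.Nodup)
    (hf : ∀ i ∈ w, i + 1 ∉ w) (j : Fin N) :
    ((j : ℕ) + 1 ∈ w → (∃ k, (wordMatching N w).partner (.inl j) = .inl k) ∧
      (∃ k, (wordMatching N w).partner (.inr j) = .inr k) ∧
      (wordMatching N w).label (.inl j) = j + 1 ∧ (wordMatching N w).label (.inr j) = j + 1) ∧
    ((j : ℕ) ∈ w → (∃ k, (wordMatching N w).partner (.inl j) = .inl k) ∧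
      ∃ k, (wordMatching N w).partner (.inr j) = .inr k) ∧
    ((j : ℕ) + 1 ∉ w → (j : ℕ) ∉ w → (wordMatching N w).partner (.inl j) = .inr j ∧
      (wordMatching N w).label (.inl j) = j + 1) := by
  induction w generalizing j with
  | nil => exact ⟨by simp, by simp, fun _ _ => ⟨rfl, rfl⟩⟩
  | cons i w ih =>
    have ih := ih (fun j hj => hw j (by simp [hj])) (List.nodup_cons.1 hn).2
      (fun j hj h => hf j (by simp [hj]) (by simp [h]))
    have hi := hw i (by simp)
    have hiw : i ∉ w := (List.nodup_cons.1 hn).1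
    have hiw' : i + 1 ∉ w := fun h => hf i (by simp) (by simp [h])
    have hiw'' : ∀ k, k + 1 = i → k ∉ w := fun k hk h => hf k (by simp [h]) (by simp [hk])
    obtain ⟨p, hp⟩ : ∃ p : Fin N, (p : ℕ) + 1 = i := ⟨⟨i - 1, by omega⟩, by simp only; omega⟩
    obtain ⟨q, hq⟩ : ∃ q : Fin N, (q : ℕ) = i := ⟨⟨i, hi.2⟩, rfl⟩
    have hpq : (Sum.inl p : Fin N ⊕ Fin N) ≠ Sum.inl q := by
      rw [Ne, Sum.inl.injEq, Fin.ext_iff]; omega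
    have hS : wordMatching N (i :: w) = (wordMatching N w).join _ _ hpq i := by
      rw [wordMatching, List.foldr_cons, ← wordMatching, sideJoin, dif_pos hi]
      congr 2 <;> rw [Function.Embedding.inl_apply, Sum.inl.injEq, Fin.ext_iff] <;> simp only <;>
        omega
    obtain ⟨pp, lp⟩ := (ih p).2.2 (by rw [hp]; exact hiw) (hiw'' _ hp)
    obtain ⟨pq, lq⟩ := (ih q).2.2 (by rw [hq]; exact hiw') (by rw [hq]; exact hiw)
    have hpp := (wordMatching N w).partner_partner
    have pp' : (wordMatching N w).partner (.inr p) = .inl p := by rw [← pp, hpp]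
    have pq' : (wordMatching N w).partner (.inr q) = .inl q := by rw [← pq, hpp]
    rw [hS]
    have hpq' : p ≠ q := fun e => hpq (by rw [e])
    by_cases hjp : j = p
    · subst hjp
      have hji : (j : ℕ) ∉ i :: w := by
        rw [List.mem_cons, not_or]
        exact ⟨by omega, hiw'' _ hp⟩
      refine ⟨fun _ => ⟨⟨q, ?_⟩, ⟨q, ?_⟩, ?_, ?_⟩, fun h => (hji h).elim, fun h => ?_⟩
      · simp [LabelledMatching.join]
      · simp [LabelledMatching.join, pp', pq]
      · simp [LabelledMatching.join, hp]
      · simp only [LabelledMatching.join, pp', lp, lq]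
        simp
        omega
      · simp [hp] at h
    by_cases hjq : j = q
    · subst hjq
      have hji : (j : ℕ) + 1 ∉ i :: w := by
        rw [List.mem_cons, not_or]
        exact ⟨by omega, by rwa [hq]⟩
      refine ⟨fun h => (hji h).elim, fun _ => ⟨⟨p, ?_⟩, ⟨p, ?_⟩⟩, fun _ h => ?_⟩
      · simp [LabelledMatching.join]
      · simp [LabelledMatching.join, pq', pp, hpq'.symm]
      · simp [hq] at h
    have h₁ : (j : ℕ) + 1 ∈ i :: w ↔ (j : ℕ) + 1 ∈ w := by
      rw [List.mem_cons, or_iff_right]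
      intro e; exact hjp (Fin.ext (by omega))
    have h₂ : (j : ℕ) ∈ i :: w ↔ (j : ℕ) ∈ w := by
      rw [List.mem_cons, or_iff_right]
      intro e; exact hjq (Fin.ext (by omega))
    have hne : ∀ v : Fin N ⊕ Fin N, v ≠ .inr p → v ≠ .inr q →
        (wordMatching N w).partner v ≠ .inl p ∧ (wordMatching N w).partner v ≠ .inl q := by
      intro v hv hv'
      constructor
      · intro e
        exact hv (by rw [← hpp v, e, pp])
      · intro e
        exact hv' (by rw [← hpp v, e, pq])
    have n₁ := hne (.inl j) (by simp) (by simp)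
    have n₂ := hne (.inr j) (by simpa using hjp) (by simpa using hjq)
    rw [h₁, h₂]
    simpa [LabelledMatching.join, hjp, hjq, n₁.1, n₁.2, n₂.1, n₂.2] using ih j

namespace FibonacciSet

theorem one_le_of_mem_freeWord {S : FibonacciSet N} {i : ℕ} (h : i ∈ S.freeWord) :
    1 ≤ i ∧ i < N :=
  ⟨(mem_freeSet.1 (mem_freeWord.1 h)).1.1, lt_of_mem_freeSet (mem_freeWord.1 h)⟩

/-- The matching of the free element. -/
theorem wordMatching_freeWord (S : FibonacciSet N) (j : Fin N) :
    ((j : ℕ) + 1 ∈ S.freeSet → (∃ k, (wordMatching N S.freeWord).partner (.inl j) = .inl k) ∧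
      (∃ k, (wordMatching N S.freeWord).partner (.inr j) = .inr k) ∧
      (wordMatching N S.freeWord).label (.inl j) = j + 1 ∧
      (wordMatching N S.freeWord).label (.inr j) = j + 1) ∧
    ((j : ℕ) + 1 ∈ S.carrier → (wordMatching N S.freeWord).partner (.inl j) = .inr j ∧
      (wordMatching N S.freeWord).label (.inl j) = j + 1) ∧
    ((j : ℕ) + 1 ∉ S.carrier → ∃ k, (wordMatching N S.freeWord).partner (.inl j) = .inl k) := by
  obtain ⟨h₁, h₂, h₃⟩ := wordMatching_of_far (w := S.freeWord)
    (fun i hi => one_le_of_mem_freeWord hi) (Finset.sort_nodup _ _)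
    (fun i hi h => succ_notMem_freeSet (mem_freeWord.1 hi) (mem_freeWord.1 h)) j
  rw [mem_freeWord] at h₁ h₂ h₃
  rw [mem_freeWord] at h₃
  refine ⟨h₁, fun h => h₃ (fun h' => (mem_freeSet.1 h').2.1 h)
    (fun h' => succ_notMem_of_mem_freeSet h' h), fun h => ?_⟩
  by_cases hj : (j : ℕ) + 1 ∈ S.freeSet
  · exact (h₁ hj).1
  · obtain ⟨k, hk, e⟩ := pred_mem_freeSet (by omega) (by omega) h hj
    obtain rfl : k = j := by omega
    exact (h₂ hk).1

theorem crossLabels_freeWord (S : FibonacciSet N) :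
    crossLabels .inr (wordMatching N S.freeWord) = S.carrier.val := by
  have hmem : ∀ v, v ∈ Finset.univ.filter (fun v => (¬ ∃ j, Function.Embedding.inr j = v) ∧
      ∃ j, Function.Embedding.inr j = (wordMatching N S.freeWord).partner v) ↔
      ∃ j : Fin N, v = .inl j ∧ (j : ℕ) + 1 ∈ S.carrier := by
    intro v
    simp only [Finset.mem_filter, Finset.mem_univ, true_and, Function.Embedding.inr_apply]
    constructor
    · rintro ⟨h, k, hk⟩
      rcases v with j | j
      · refine ⟨j, rfl, ?_⟩
        by_contra hj
        obtain ⟨l, hl⟩ := (S.wordMatching_freeWord j).2.2 hj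
        rw [hl] at hk
        simp at hk
      · exact (h ⟨j, rfl⟩).elim
    · rintro ⟨j, rfl, hj⟩
      exact ⟨by simp, j, ((S.wordMatching_freeWord j).2.1 hj).1.symm⟩
  rw [crossLabels, ← Finset.image_val_of_injOn]
  · congr 1
    ext x
    rw [Finset.mem_image]
    constructor
    · rintro ⟨v, hv, rfl⟩
      obtain ⟨j, rfl, hj⟩ := (hmem v).1 hv
      rwa [((S.wordMatching_freeWord j).2.1 hj).2]
    · intro hx
      have := Finset.mem_Icc.1 (S.subset_Icc hx)
      have hx' : ((⟨x - 1, by omega⟩ : Fin N) : ℕ) + 1 = x := by simp only; omega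
      refine ⟨.inl ⟨x - 1, by omega⟩, (hmem _).2 ⟨_, rfl, by rwa [hx']⟩, ?_⟩
      rw [((S.wordMatching_freeWord ⟨x - 1, by omega⟩).2.1 (by rwa [hx'])).2, hx']
  · intro v hv v' hv' e
    obtain ⟨j, rfl, hj⟩ := (hmem v).1 hv
    obtain ⟨j', rfl, hj'⟩ := (hmem v').1 hv'
    rw [((S.wordMatching_freeWord j).2.1 hj).2, ((S.wordMatching_freeWord j').2.1 hj').2] at e
    rw [Fin.ext (show (j : ℕ) = j' by omega)]

theorem countGe_eq_countP (S : FibonacciSet N) (x : ℕ) :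
    S.countGe x = S.carrier.val.countP (x ≤ ·) := by
  rw [countGe, Multiset.countP_eq_card_filter]
  rfl

end FibonacciSet

theorem mem_freeSet_of_prefix {S : FibonacciSet N} {j : ℕ}
    (h : [j + 1] <+: adjFilter j S.freeWord) : j + 1 ∈ S.freeSet :=
  FibonacciSet.mem_freeWord.1 (mem_adjFilter.1 (h.mem (List.mem_singleton_self _))).1

theorem label_wordMatching_inr_le (w : List ℕ) (j : Fin N) :
    (wordMatching N w).label (Sum.inr j) ≤ j + 1 := by
  rw [wordMatching_eq_foldr_inr]
  exact label_foldr_sideJoin_le .inr (fun _ => le_rfl) _ j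

/-- The propagating labels of a factorized word are the elements of the Fibonacci set. -/
theorem TriangularWord.crossLabels_eq {w : List ℕ} {S : FibonacciSet N} {ρ τ : List ℕ}
    (h : TriangularWord N w S ρ τ) (hred : ReducedWord w) (hw : ∀ i ∈ w, 1 ≤ i ∧ i < N) :
    crossLabels .inr (wordMatching N w) = S.carrier.val := by
  have hred' := h.traceEq.reducedWord hred
  have hρ : ∀ i ∈ ρ, 1 ≤ i ∧ i < N := fun i hi => hw i ((h.traceEq.mem_iff i).2 (by simp [hi]))
  have hτ : ∀ i ∈ τ, 1 ≤ i ∧ i < N := fun i hi => hw i ((h.traceEq.mem_iff i).2 (by simp [hi]))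
  have inv : SideInvariant .inl S.freeWord (wordMatching N S.freeWord) := by
    refine ⟨label_wordMatching_le _, fun j hj => ?_⟩
    obtain ⟨⟨k, hk⟩, -, hl, -⟩ := (S.wordMatching_freeWord j).1 (mem_freeSet_of_prefix hj)
    exact ⟨⟨k, hk.symm⟩, hl⟩
  have same := inv.foldr hρ hred'.of_append_left h.left
  rw [← wordMatching_append'] at same
  -- Joins on the left do not touch the arcs within the right side, so the invariant of the free
  -- element survives there and `τ` can be absorbed from the right.
  have inv' : SideInvariant .inr S.freeWord (wordMatching N (ρ ++ S.freeWord)) := by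
    refine ⟨fun j => ?_, fun j hj => ?_⟩
    · exact label_wordMatching_inr_le _ _
    · obtain ⟨-, ⟨k, hk⟩, -, hl⟩ := (S.wordMatching_freeWord j).1 (mem_freeSet_of_prefix hj)
      have hj' : ¬ ∃ k, Function.Embedding.inl k = (Sum.inr j : Fin N ⊕ Fin N) := by simp
      have hp := same.partner_eq _ hj' (by rw [hk]; simp)
      exact ⟨⟨k, by rw [Function.Embedding.inr_apply, Function.Embedding.inr_apply, hp, hk]⟩,
        (same.label_eq _ hj').trans hl⟩
  have hrev : TraceEq S.freeWord.reverse S.freeWord := fun c => by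
    rw [adjFilter_reverse, S.adjFilter_freeWord]
    split_ifs <;> rfl
  have hredτ : ReducedWord (τ.reverse ++ S.freeWord) := by
    rw [List.append_assoc] at hred'
    have := hred'.of_append_right.reverse
    rw [List.reverse_append] at this
    exact (hrev.append_left τ.reverse).reducedWord this
  have same' := inv'.foldr (ρ := τ.reverse) (fun i hi => hτ i (List.mem_reverse.1 hi)) hredτ
    (fun c hc hc' => by
      rw [adjFilter_reverse, ← List.reverse_prefix, List.reverse_reverse]
      exact h.right c hc hc')
  rw [← wordMatching_append] at same'
  rw [h.traceEq.wordMatching_eq, same'.crossLabels_eq, ← crossLabels_inl_eq_inr,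
    same.crossLabels_eq, crossLabels_inl_eq_inr, S.crossLabels_freeWord]

theorem TriangularWord.carrier_eq {σ : Equiv.Perm (Fin N)} {S : FibonacciSet N} {ρ τ : List ℕ}
    (h : TriangularWord N (permWord σ) S ρ τ) :
    (S.carrier : Set ℕ) = LabelledArcs.propLab (LabelledArcs.ofPerm σ) := by
  rw [ofPerm_eq_toArcs, propLab_toArcs_eq,
    h.crossLabels_eq (reducedWord_permWord σ) (permWord_range σ)]
  rfl

end

/-! ### The triangular factorization theorem. -/

theorem mainTheorem6 {K : Type*} [Field K] (N : ℕ) (X : Fin (N - 1) → K) (Y : Fin (N - 2) → K)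
    (σ : Equiv.Perm (Fin N)) :
    ∃ S : FibonacciSet N, (S.carrier : Set ℕ) = LabelledArcs.propLab (LabelledArcs.ofPerm σ) ∧
      ∃ ρ τ : Equiv.Perm (Fin N),
        okadaPerm N X Y σ = okadaPerm N X Y ρ * okadaFree N X Y S * okadaPerm N X Y τ ∧
        permLength σ = S.freeSet.card + permLength ρ + permLength τ ∧
        (∃ A B I : FibonacciSet N,
          (A.carrier : Set ℕ) = LabelledArcs.propLab (LabelledArcs.ofPerm ρ) ∧
          (B.carrier : Set ℕ) = LabelledArcs.propLab (LabelledArcs.ofPerm τ) ∧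
          IsGLB {A, B} I ∧ S ≤ I) ∧
        ∀ ρ' τ' : Equiv.Perm (Fin N),
          okadaPerm N X Y σ = okadaPerm N X Y ρ' * okadaFree N X Y S * okadaPerm N X Y τ' →
          permLength σ = S.freeSet.card + permLength ρ' + permLength τ' →
          ρ' = ρ ∧ τ' = τ := by
  have hred := reducedWord_permWord σ
  have hrange := permWord_range σ
  obtain ⟨S, ρw, τw, hS⟩ := hred.exists_triangularWord hrange
  have hred' := hS.traceEq.reducedWord hred
  have hmem := fun i => hS.traceEq.mem_iff i
  obtain ⟨ρ, hρ⟩ := hred'.of_append_left.of_append_left.exists_perm (N := N)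
    fun i hi => hrange i ((hmem i).2 (by simp [hi]))
  obtain ⟨τ, hτ⟩ := hred'.of_append_right.exists_perm (N := N)
    fun i hi => hrange i ((hmem i).2 (by simp [hi]))
  have ht : TraceEq (permWord σ) (permWord ρ ++ S.freeWord ++ permWord τ) :=
    hS.traceEq.trans ((hρ.append_right S.freeWord).append hτ)
  have hfree : okadaFree N X Y S = okadaWord X Y S.freeWord := rfl
  have hcard : S.freeWord.length = S.freeSet.card := Finset.length_sort _
  obtain ⟨A, α, α', hA⟩ := (reducedWord_permWord ρ).exists_triangularWord (permWord_range ρ)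
  obtain ⟨B, β, β', hB⟩ := (reducedWord_permWord τ).exists_triangularWord (permWord_range τ)
  have cS := hS.crossLabels_eq hred hrange
  have cA := hA.crossLabels_eq (reducedWord_permWord ρ) (permWord_range ρ)
  have cB := hB.crossLabels_eq (reducedWord_permWord τ) (permWord_range τ)
  refine ⟨S, hS.carrier_eq, ρ, τ, ?_, ?_, ⟨A, B, A.inf B, hA.carrier_eq, hB.carrier_eq,
    A.isGLB_inf B, (A.isGLB_inf B).2 ?_⟩, fun ρ' τ' h hl => ?_⟩
  · rw [hfree]
    simp only [okadaPerm_eq_okadaWord, ← okadaWord_append]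
    exact ht.okadaWord_eq X Y
  · have := ht.perm.length_eq
    simp only [List.length_append, hcard] at this
    simp only [permLength_eq_length]
    omega
  · rintro C (rfl | rfl)
    -- The diagram of `σ` arises from that of `ρ` by joins on the right only, none of which raises a
    -- count.
    · rw [FibonacciSet.le_iff_countGe]
      intro x
      rw [FibonacciSet.countGe_eq_countP, FibonacciSet.countGe_eq_countP, ← cS, ← cA,
        ht.wordMatching_eq, List.append_assoc, wordMatching_append]
      exact countP_crossLabels_foldr_le _ _ x _
    -- Likewise it arises from the diagram of `τ` by joins on the left.
    · rw [FibonacciSet.le_iff_countGe]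
      intro x
      rw [FibonacciSet.countGe_eq_countP, FibonacciSet.countGe_eq_countP, ← cS, ← cB,
        ht.wordMatching_eq, wordMatching_append', ← crossLabels_inl_eq_inr,
        ← crossLabels_inl_eq_inr]
      exact countP_crossLabels_foldr_le _ _ x _
  · have hr : ∀ i ∈ permWord ρ' ++ S.freeWord ++ permWord τ', 1 ≤ i ∧ i < N := by
      intro i hi
      rw [List.mem_append, List.mem_append] at hi
      rcases hi with (hi | hi) | hi
      · exact permWord_range ρ' i hi
      · exact FibonacciSet.one_le_of_mem_freeWord hi
      · exact permWord_range τ' i hi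
    have ht' : TraceEq (permWord σ) (permWord ρ' ++ S.freeWord ++ permWord τ') := by
      -- The length equation rules out that the right-hand product was shortened by a relation.
      refine traceEq_of_okadaPerm_eq X Y hr ?_ ?_
      · rw [h, hfree, okadaWord_append, okadaWord_append]; rfl
      · rw [hl]
        simp only [List.length_append, hcard, permLength_eq_length]
        omega
    obtain ⟨h₁, h₂⟩ := hS.unique hred (fun i hi => (hrange i hi).2) ht'
    exact ⟨permWord_injective (h₁.trans hρ), permWord_injective (h₂.trans hτ)⟩
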